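/- **Notation.** Let $f\colon Y\to X$ be a morphism of schemes. For a scheme $Z$, let $\mathbf{\acute Et}_{/Z}$ be the category of étale $Z$-schemes with the étale topology, $Z_{\text{ét}}$ its topos of sheaves of sets, and let $\mathbf{\acute Et}_{\mathrm f/Z}$ be the full subcategory of finite étale $Z$-schemes with the topology induced by the étale topology, $Z_{\text{fét}}$ its topos of sheaves of sets. The inclusion $\mathbf{\acute Et}_{\mathrm f/Z}\to\mathbf{\acute Et}_{/Z}$ defines a morphism of topoi $\rho_Z\colon Z_{\text{ét}}\to Z_{\text{fét}}$, and a morphism of schemes $g\colon Z'\to Z$ defines, by base change, a morphism of topoi $g_{\text{fét}}\colon Z'_{\text{fét}}\to Z_{\text{fét}}$. For $U\in\mathbf{\acute Et}_{/X}$ put $U_Y=U\times_XY$ and let $h_U\colon U_Y\to Y$ be the projection. Let $E$ be the category whose objects $(V\to U)$ are pairs of an étale $X$-scheme $U$ and a finite étale $U_Y$-scheme $V$, a morphism $(V'\to U')\to(V\to U)$ being an $X$-morphism $U'\to U$ together with a morphism $V'\to V$ lying over $U'_Y\to U_Y$. Give $E$ the co-evanescent topology, that is, the topology generated by - the vertical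 families $\big((V_i\to U)\to(V\to U)\big)_i$, where $(V_i\to V)_i$ is a covering of $\mathbf{\acute Et}_{\mathrm f/U_Y}$, and - the cartesian families $\big((V\times_{U_Y}(U_i)_Y\to U_i)\to(V\to U)\big)_i$, where $(U_i\to U)_i$ is an étale covering, and let $\widetilde E$ be the topos of sheaves of sets on $E$. Let $E_{\mathrm{coh}}\subset E$ be the full subcategory of the objects $(V\to U)$ with $U$ of finite presentation over $X$, with the topology generated by the vertical and the cartesian families whose members lie in $E_{\mathrm{coh}}$; the statements about $E_{\mathrm{coh}}$ below refer to restriction along this inclusion. The functor $\mathbf{\acute Et}_{\mathrm f/Y}\to E$, $V\mapsto(V\to X)$, defines a morphism of topoi $\beta\colon\widetilde E\to Y_{\text{fét}}$, so that $(\beta_*G)(V)=G(V\to X)$. The functor $E\to\mathbf{\acute Et}_{/Y}$, $(V\to U)\mapsto V$, defines a morphism of topoi $\Psi\colon Y_{\text{ét}}\to\widetilde E$. One has $\beta\Psi=\rho_Y$, hence a canonical isomorphism $\Psi^*\beta^*\simeq\rho_Y^*$, which gives by adjunction a morphism $\beta^*\to\Psi_*\rho_Y^*$. For $F\in Y_{\text{fét}}$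 and a morphism $g\colon U'\to U$ of $\mathbf{\acute Et}_{/X}$, with base change $g_Y\colon U'_Y\to U_Y$, the isomorphism $(g_Y)_{\text{fét}}^*(h_U)^*_{\text{fét}}F\simeq(h_{U'})^*_{\text{fét}}F$ gives by adjunction a morphism $(h_U)^*_{\text{fét}}F\to (g_Y)_{\text{fét}*}(h_{U'})^*_{\text{fét}}F$. These transition morphisms make $(V\to U)\mapsto\big((h_U)^*_{\text{fét}}F\big)(V)$ a presheaf on $E$, denoted $\{U\mapsto(h_U)^*_{\text{fét}}F\}$. It has a canonical morphism to $\beta^*F$: for each $U$, it is the one adjoint to the composites $F(W)\to(\beta^*F)(W\to X)\to(\beta^*F)(W\times_YU_Y\to U)$, for $W\in\mathbf{\acute Et}_{\mathrm f/Y}$. A scheme $Y$ is *étale-locally connected* if, for every étale morphism $Y'\to Y$, every connected component of $Y'$ is open in $Y'$. A scheme is *coherent* if it is quasi-compact and quasi-separated. **Proposition.** Assume that $X$ is quasi-separated and that $Y$ is coherent and étale-locally connected. Then the inverse image functors $\beta^*$, $\rho_Y^*$ and $(h_U)^*_{\text{fét}}$ (for all $U\in\mathbf{\acute Et}_{/X}$)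 exist, and: 1. For every sheaf $F$ of $Y_{\text{fét}}$, the presheaf $\{U\mapsto(h_U)^*_{\text{fét}}F\}$ is a sheaf on $E_{\mathrm{coh}}$, and its canonical morphism to $\beta^*F$ is an isomorphism on $E_{\mathrm{coh}}$. 2. The adjunction morphism $\mathrm{id}\to\beta_*\beta^*$ is an isomorphism. 3. The morphism $\beta^*\to\Psi_*\rho_Y^*$ is an isomorphism. -/

import Mathlib

open CategoryTheory Opposite Limits AlgebraicGeometry

universe w u

namespace Faltings

noncomputable section

/-! ### Generalities -/

/-- If a functor preserves compatible families and maps a sieve to a covering sieve, then the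
restriction along the functor of a sheaf satisfies the sheaf condition for the sieve. -/
lemma isSheafFor_of_functorPushforward_mem {C : Type*} [Category* C] {D : Type*} [Category* D]
    {K : GrothendieckTopology D} {F : C ⥤ D} (hF : CompatiblePreserving.{w} K F)
    (G : Sheaf K (Type w)) {Z : C} (S : Sieve Z) (hS : S.functorPushforward F ∈ K (F.obj Z)) :
    Presieve.IsSheafFor (F.op ⋙ G.obj) S.arrows := by
  intro x hx
  apply existsUnique_of_exists_of_unique
  · have H := (isSheaf_iff_isSheaf_of_type _ _).1 G.2 _ hS
    exact ⟨H.amalgamate (x.functorPushforward F) (hx.functorPushforward hF),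
      fun V f hf => (H.isAmalgamation (hx.functorPushforward hF) (F.map f) _).trans
        (hF.apply_map _ hx hf)⟩
  · intro y₁ y₂ hy₁ hy₂
    apply (((isSheaf_iff_isSheaf_of_type _ _).1 G.2).isSeparated _ hS).ext
    rintro Y _ ⟨Z, g, h, hg, rfl⟩
    simpa using! congrArg _ ((hy₁ g hg).trans (hy₂ g hg).symm)

/-! ### Étale and finite étale sites -/

/-- Étale morphisms of schemes, as a property of morphisms. -/
def etMor : MorphismProperty Scheme.{u} := @Etale.{u}

/-- Finite étale morphisms of schemes, as a property of morphisms. -/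
def finEtMor : MorphismProperty Scheme.{u} := fun _ _ f => IsFinite f ∧ Etale f

lemma finEtMor_le_etMor : finEtMor.{u} ≤ etMor.{u} := fun _ _ _ h => h.2

instance : etMor.{u}.IsMultiplicative :=
  inferInstanceAs (MorphismProperty.IsMultiplicative (@Etale.{u} : MorphismProperty Scheme.{u}))
instance : etMor.{u}.IsStableUnderBaseChange :=
  inferInstanceAs
    (MorphismProperty.IsStableUnderBaseChange (@Etale.{u} : MorphismProperty Scheme.{u}))
instance : etMor.{u}.HasOfPostcompProperty etMor.{u} :=
  inferInstanceAs (MorphismProperty.HasOfPostcompProperty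
    (@Etale.{u} : MorphismProperty Scheme.{u}) (@Etale.{u} : MorphismProperty Scheme.{u}))

instance : finEtMor.{u}.IsMultiplicative where
  id_mem _ := ⟨inferInstance, inferInstance⟩
  comp_mem _ _ := fun ⟨_, _⟩ ⟨_, _⟩ => ⟨inferInstance, inferInstance⟩
instance : finEtMor.{u}.IsStableUnderBaseChange where
  of_isPullback h hf :=
    ⟨MorphismProperty.of_isPullback (P := @IsFinite.{u}) h hf.1,
      MorphismProperty.of_isPullback (P := @Etale.{u}) h hf.2⟩
instance : finEtMor.{u}.HasOfPostcompProperty finEtMor.{u} := by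
  rw [MorphismProperty.hasOfPostcompProperty_iff_le_diagonal]
  rintro X Y f ⟨h1, h2⟩
  refine ⟨?_, ?_⟩
  · change IsFinite (pullback.diagonal f)
    infer_instance
  · change Etale (pullback.diagonal f)
    infer_instance

/-- The category of schemes étale over `X`. -/
abbrev Et (X : Scheme.{u}) : Type (u + 1) := MorphismProperty.Over etMor.{u} ⊤ X

/-- The category of schemes finite étale over `X`. -/
abbrev FEt (X : Scheme.{u}) : Type (u + 1) := MorphismProperty.Over finEtMor.{u} ⊤ X

/-- The étale topology on the category of schemes étale over `X`. -/
def etTopology (X : Scheme.{u}) : GrothendieckTopology (Et X) :=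
  X.smallGrothendieckTopology etMor.{u}

/-- The inclusion of the category of finite étale `X`-schemes in that of étale `X`-schemes. -/
abbrev fetToEt (X : Scheme.{u}) : FEt X ⥤ Et X :=
  MorphismProperty.Over.changeProp X finEtMor_le_etMor le_rfl

/-- The topology on the category of finite étale `X`-schemes induced by the étale topology. -/
def fetTopology (X : Scheme.{u}) : GrothendieckTopology (FEt X) :=
  (fetToEt X).inducedTopology (etTopology X)

instance (X : Scheme.{u}) : (fetToEt X).IsContinuous (fetTopology X) (etTopology X) :=
  inferInstanceAs ((fetToEt X).IsContinuous ((fetToEt X).inducedTopology (etTopology X)) _)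

lemma mem_etTopology {X : Scheme.{u}} {V : Et X} (S : Sieve V) :
    S ∈ etTopology X V ↔ ∀ v : V.left, ∃ (W : Et X) (g : W ⟶ V) (w : W.left),
      S g ∧ g.left w = v := by
  unfold etTopology
  rw [Scheme.smallGrothendieckTopology_eq_toGrothendieck_smallPretopology _ le_rfl,
    Scheme.mem_toGrothendieck_smallPretopology]
  refine forall_congr' fun v => ⟨?_, ?_⟩
  · rintro ⟨W, g, w, h1, -, h2⟩
    exact ⟨W, g, w, h1, h2⟩
  · rintro ⟨W, g, w, h1, h2⟩
    refine ⟨W, g, w, h1, ?_, h2⟩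
    have h : etMor (g.left ≫ V.hom) := by
      rw [MorphismProperty.Over.w]
      exact W.prop
    exact etMor.of_postcomp _ _ V.prop h

instance (X : Scheme.{u}) : PreservesFiniteLimits (fetToEt X) := by
  constructor
  intro J _ _
  have : PreservesLimitsOfShape J (fetToEt X ⋙ MorphismProperty.Over.forget etMor.{u} ⊤ X) :=
    inferInstanceAs (PreservesLimitsOfShape J (MorphismProperty.Over.forget finEtMor.{u} ⊤ X))
  exact preservesLimitsOfShape_of_reflects_of_preserves _
    (MorphismProperty.Over.forget etMor.{u} ⊤ X)

/-- The fibre product of two objects over a third one, in a category of schemes over `X` whose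
structural morphism has a given property. -/
def fiberProd {P : MorphismProperty Scheme.{u}} [P.IsStableUnderBaseChange] [P.IsMultiplicative]
    [P.HasOfPostcompProperty P] {X : Scheme.{u}} {A B Z : P.Over ⊤ X} (f : A ⟶ Z) (g : B ⟶ Z) :
    P.Over ⊤ X :=
  MorphismProperty.Over.mk ⊤ (pullback.fst f.left g.left ≫ A.hom)
    (P.comp_mem _ _ (P.pullback_fst _ _
      (P.of_postcomp g.left Z.hom Z.prop (by rw [MorphismProperty.Over.w]; exact B.prop))) A.prop)

section
variable {P : MorphismProperty Scheme.{u}} [P.IsStableUnderBaseChange] [P.IsMultiplicative]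
    [P.HasOfPostcompProperty P] {X : Scheme.{u}} {A B Z : P.Over ⊤ X} (f : A ⟶ Z) (g : B ⟶ Z)

/-- The first projection. -/
def fiberProd.fst : fiberProd f g ⟶ A :=
  MorphismProperty.Over.homMk (pullback.fst f.left g.left) rfl

/-- The second projection. -/
def fiberProd.snd : fiberProd f g ⟶ B :=
  MorphismProperty.Over.homMk (pullback.snd f.left g.left) (by
    change pullback.snd f.left g.left ≫ B.hom = pullback.fst f.left g.left ≫ A.hom
    rw [← MorphismProperty.Over.w g, ← MorphismProperty.Over.w f, pullback.condition_assoc])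

lemma fiberProd.condition : fiberProd.fst f g ≫ f = fiberProd.snd f g ≫ g :=
  MorphismProperty.Over.Hom.ext (pullback.condition (f := f.left) (g := g.left))

/-- The morphism to the fibre product given by its two components. -/
def fiberProd.lift {S : Scheme.{u}} (r₁ : S ⟶ A.left) (r₂ : S ⟶ B.left)
    (e : r₁ ≫ f.left = r₂ ≫ g.left) : S ⟶ (fiberProd f g).left :=
  pullback.lift r₁ r₂ e

lemma fiberProd.lift_fst {S : Scheme.{u}} (r₁ : S ⟶ A.left) (r₂ : S ⟶ B.left)
    (e : r₁ ≫ f.left = r₂ ≫ g.left) :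
    fiberProd.lift f g r₁ r₂ e ≫ (fiberProd.fst f g).left = r₁ :=
  pullback.lift_fst _ _ _

lemma fiberProd.lift_snd {S : Scheme.{u}} (r₁ : S ⟶ A.left) (r₂ : S ⟶ B.left)
    (e : r₁ ≫ f.left = r₂ ≫ g.left) :
    fiberProd.lift f g r₁ r₂ e ≫ (fiberProd.snd f g).left = r₂ :=
  pullback.lift_snd _ _ _

lemma fiberProd.lift_hom {S : Scheme.{u}} (r₁ : S ⟶ A.left) (r₂ : S ⟶ B.left)
    (e : r₁ ≫ f.left = r₂ ≫ g.left) :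
    fiberProd.lift f g r₁ r₂ e ≫ (fiberProd f g).hom = r₁ ≫ A.hom :=
  pullback.lift_fst_assoc _ _ _ _

end

lemma mem_fetTopology {X : Scheme.{u}} {V : FEt X} (S : Sieve V) :
    S ∈ fetTopology X V ↔ ∀ v : V.left, ∃ (W : FEt X) (g : W ⟶ V) (w : W.left),
      S g ∧ g.left w = v := by
  constructor
  · intro hS v
    have h := (CoverPreserving.of_isContinuous (fetToEt X) (fetTopology X)
      (etTopology X)).cover_preserve hS
    rw [mem_etTopology] at h
    obtain ⟨_, _, w, ⟨W, g, k, hg, rfl⟩, rfl⟩ := h v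
    exact ⟨W, g, k.left w, hg, rfl⟩
  · intro hS
    apply Sheaf.mem_finestTopology_of_forall_isSheafFor
    rintro - ⟨G, rfl⟩ V' f
    have : RepresentablyFlat (fetToEt X) := flat_of_preservesFiniteLimits _
    apply isSheafFor_of_functorPushforward_mem (compatiblePreservingOfFlat _ _)
    rw [mem_etTopology]
    intro v'
    obtain ⟨W, g, w, hg, e⟩ := hS (f.left v')
    obtain ⟨z, hz1, hz2⟩ := Scheme.Pullback.exists_preimage_pullback v' w e.symm
    have h : (S.pullback f) (fiberProd.fst f g) := by
      change S (fiberProd.fst f g ≫ f)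
      rw [fiberProd.condition]
      exact S.downward_closed hg _
    exact ⟨_, (fetToEt X).map (fiberProd.fst f g), z,
      Sieve.image_mem_functorPushforward (fetToEt X) (S.pullback f) h, hz1⟩

/-! ### Base change -/

/-- The base change functor `U ↦ U ×_X Y` between categories of étale schemes. -/
abbrev etBaseChange {X Y : Scheme.{u}} (f : Y ⟶ X) : Et X ⥤ Et Y :=
  MorphismProperty.Over.pullback etMor.{u} ⊤ f

/-- The base change functor `V ↦ V ×_X Y` between categories of finite étale schemes. -/
abbrev fetBaseChange {X Y : Scheme.{u}} (f : Y ⟶ X) : FEt X ⥤ FEt Y :=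
  MorphismProperty.Over.pullback finEtMor.{u} ⊤ f

section

variable {P : MorphismProperty Scheme.{u}} [P.IsStableUnderBaseChange] {X Y : Scheme.{u}}

/-- A morphism to a base change `V ×_X Y` of objects over `Y`, given by a morphism to `V` which is
compatible with `f : Y ⟶ X`. -/
def bcLift {f : Y ⟶ X} {V' : P.Over ⊤ Y} {V : P.Over ⊤ X} (r : V'.left ⟶ V.left)
    (w : r ≫ V.hom = V'.hom ≫ f) : V' ⟶ (MorphismProperty.Over.pullback P ⊤ f).obj V :=
  MorphismProperty.Over.homMk (pullback.lift r V'.hom w) (pullback.lift_snd _ _ _)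

/-- The projection `V ×_X Y ⟶ V`. -/
def bcFst (f : Y ⟶ X) (V : P.Over ⊤ X) :
    ((MorphismProperty.Over.pullback P ⊤ f).obj V).left ⟶ V.left :=
  pullback.fst V.hom f

lemma bcFst_w (f : Y ⟶ X) (V : P.Over ⊤ X) :
    bcFst f V ≫ V.hom = ((MorphismProperty.Over.pullback P ⊤ f).obj V).hom ≫ f :=
  pullback.condition

lemma bcLift_fst {f : Y ⟶ X} {V' : P.Over ⊤ Y} {V : P.Over ⊤ X} (r : V'.left ⟶ V.left)
    (w : r ≫ V.hom = V'.hom ≫ f) : (bcLift r w).left ≫ bcFst f V = r :=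
  pullback.lift_fst _ _ _

lemma bcMap_fst (f : Y ⟶ X) {V' V : P.Over ⊤ X} (g : V' ⟶ V) :
    ((MorphismProperty.Over.pullback P ⊤ f).map g).left ≫ bcFst f V = bcFst f V' ≫ g.left :=
  pullback.lift_fst _ _ _

lemma bc_hom_ext {f : Y ⟶ X} {V' : P.Over ⊤ Y} {V : P.Over ⊤ X}
    {a b : V' ⟶ (MorphismProperty.Over.pullback P ⊤ f).obj V}
    (h : a.left ≫ bcFst f V = b.left ≫ bcFst f V) : a = b := by
  apply MorphismProperty.Over.Hom.ext
  apply pullback.hom_ext h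
  exact (MorphismProperty.Over.w a).trans (MorphismProperty.Over.w b).symm

/-- The morphism to a base change given by its two components. -/
def bcPair {f : Y ⟶ X} {V : P.Over ⊤ X} {S : Scheme.{u}} (r : S ⟶ V.left) (s : S ⟶ Y)
    (w : r ≫ V.hom = s ≫ f) : S ⟶ ((MorphismProperty.Over.pullback P ⊤ f).obj V).left :=
  pullback.lift r s w

lemma bcPair_fst {f : Y ⟶ X} {V : P.Over ⊤ X} {S : Scheme.{u}} (r : S ⟶ V.left) (s : S ⟶ Y)
    (w : r ≫ V.hom = s ≫ f) : bcPair r s w ≫ bcFst f V = r :=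
  pullback.lift_fst _ _ _

lemma bcPair_hom {f : Y ⟶ X} {V : P.Over ⊤ X} {S : Scheme.{u}} (r : S ⟶ V.left) (s : S ⟶ Y)
    (w : r ≫ V.hom = s ≫ f) :
    bcPair r s w ≫ ((MorphismProperty.Over.pullback P ⊤ f).obj V).hom = s :=
  pullback.lift_snd _ _ _

lemma bc_ext {f : Y ⟶ X} {V : P.Over ⊤ X} {S : Scheme.{u}}
    {a b : S ⟶ ((MorphismProperty.Over.pullback P ⊤ f).obj V).left}
    (h : a ≫ bcFst f V = b ≫ bcFst f V)
    (h' : a ≫ ((MorphismProperty.Over.pullback P ⊤ f).obj V).hom =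
      b ≫ ((MorphismProperty.Over.pullback P ⊤ f).obj V).hom) : a = b :=
  pullback.hom_ext h h'

lemma bc_isPullback (f : Y ⟶ X) (V : P.Over ⊤ X) :
    IsPullback (bcFst f V) ((MorphismProperty.Over.pullback P ⊤ f).obj V).hom V.hom f :=
  IsPullback.of_hasPullback _ _

lemma bcMap_isPullback (f : Y ⟶ X) {V' V : P.Over ⊤ X} (g : V' ⟶ V) :
    IsPullback (bcFst f V') ((MorphismProperty.Over.pullback P ⊤ f).map g).left g.left
      (bcFst f V) := by
  have h := bc_isPullback f V'
  rw [← MorphismProperty.Over.w g, ← MorphismProperty.Over.w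
    ((MorphismProperty.Over.pullback P ⊤ f).map g)] at h
  exact IsPullback.of_bot h (bcMap_fst f g).symm (bc_isPullback f V)

end

instance {X Y : Scheme.{u}} (f : Y ⟶ X) :
    (fetBaseChange f).IsContinuous (fetTopology X) (fetTopology Y) := by
  have : RepresentablyFlat (fetBaseChange f) := flat_of_preservesFiniteLimits _
  rw [Functor.isContinuous_iff_coverPreserving]
  constructor
  intro V S hS
  rw [mem_fetTopology] at hS ⊢
  intro v'
  obtain ⟨W, g, w, hg, e⟩ := hS (bcFst f V v')
  obtain ⟨z, hz1, hz2⟩ := Scheme.exists_preimage_of_isPullback (bcMap_isPullback f g) w v' e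
  exact ⟨_, (fetBaseChange f).map g, z, Sieve.image_mem_functorPushforward _ _ hg, hz2⟩

/-! ### The Faltings site -/

section Faltings

variable {X Y : Scheme.{u}} (f : Y ⟶ X)

/-- The scheme `U_Y = U ×_X Y`. -/
abbrev UY (U : Et X) : Scheme.{u} := ((etBaseChange f).obj U).left

/-- The projection `U_Y ⟶ Y`. -/
abbrev hMor (U : Et X) : UY f U ⟶ Y := ((etBaseChange f).obj U).hom

/-- The morphism `U'_Y ⟶ U_Y` induced by an `X`-morphism `U' ⟶ U`. -/
abbrev gY {U' U : Et X} (g : U' ⟶ U) : UY f U' ⟶ UY f U := ((etBaseChange f).map g).left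

lemma gY_comp {U'' U' U : Et X} (g' : U'' ⟶ U') (g : U' ⟶ U) :
    gY f (g' ≫ g) = gY f g' ≫ gY f g := by
  change ((etBaseChange f).map (g' ≫ g)).left = _
  rw [(etBaseChange f).map_comp]
  rfl

lemma gY_id (U : Et X) : gY f (𝟙 U) = 𝟙 (UY f U) := by
  change ((etBaseChange f).map (𝟙 U)).left = _
  rw [(etBaseChange f).map_id]
  rfl

lemma gY_h {U' U : Et X} (g : U' ⟶ U) : gY f g ≫ hMor f U = hMor f U' :=
  MorphismProperty.Over.w _

/-- The objects `V ⟶ U` of the Faltings site: an étale `X`-scheme `U` together with a `Y`-scheme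
`V` finite étale over `U_Y`. -/
structure FaltingsSite where
  /-- The étale `X`-scheme `U`. -/
  base : Et X
  /-- The finite étale `U_Y`-scheme `V`. -/
  cover : FEt (UY f base)

namespace FaltingsSite

variable {f}

/-- A morphism `(V' ⟶ U') ⟶ (V ⟶ U)` is given by an `X`-morphism `U' ⟶ U` and a morphism
`V' ⟶ V` lying over `U'_Y ⟶ U_Y`. -/
@[ext]
structure Hom (Z' Z : FaltingsSite f) where
  /-- The morphism `U' ⟶ U`. -/
  baseHom : Z'.base ⟶ Z.base
  /-- The morphism `V' ⟶ V`. -/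
  coverHom : Z'.cover.left ⟶ Z.cover.left
  w : coverHom ≫ Z.cover.hom = Z'.cover.hom ≫ gY f baseHom

instance : Category (FaltingsSite f) where
  Hom := Hom
  id Z := ⟨𝟙 _, 𝟙 _, by
    change _ = _ ≫ ((etBaseChange f).map (𝟙 _)).left
    rw [(etBaseChange f).map_id]
    exact (Category.id_comp _).trans (Category.comp_id _).symm⟩
  comp a b := ⟨a.baseHom ≫ b.baseHom, a.coverHom ≫ b.coverHom, by
    change _ = _ ≫ ((etBaseChange f).map (_ ≫ _)).left
    rw [(etBaseChange f).map_comp, Category.assoc, b.w, reassoc_of% a.w]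
    rfl⟩
  id_comp a := Hom.ext (Category.id_comp _) (Category.id_comp _)
  comp_id a := Hom.ext (Category.comp_id _) (Category.comp_id _)
  assoc a b c := Hom.ext (Category.assoc _ _ _) (Category.assoc _ _ _)

lemma hom_ext {Z' Z : FaltingsSite f} {a b : Z' ⟶ Z} (h : a.baseHom = b.baseHom)
    (h' : a.coverHom = b.coverHom) : a = b := Hom.ext h h'

end FaltingsSite

/-- The functor `(V ⟶ U) ↦ U`. -/
def siteProj : FaltingsSite f ⥤ Et X where
  obj Z := Z.base
  map a := a.baseHom

/-- The functor `V ↦ (V ⟶ U)`, from the finite étale `U_Y`-schemes to the Faltings site. -/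
def alpha (U : Et X) : FEt (UY f U) ⥤ FaltingsSite f where
  obj V := ⟨U, V⟩
  map {V' V} b := ⟨𝟙 U, b.left, by
    change _ = _ ≫ ((etBaseChange f).map (𝟙 _)).left
    rw [(etBaseChange f).map_id, MorphismProperty.Over.w]
    exact (Category.comp_id _).symm⟩
  map_id _ := rfl
  map_comp _ _ := FaltingsSite.hom_ext (Category.id_comp _).symm rfl

/-- The functor `(V ⟶ U) ↦ V`, where the `Y`-scheme `V` is étale. -/
def psiPlus : FaltingsSite f ⥤ Et Y where
  obj Z := MorphismProperty.Over.mk ⊤ (Z.cover.hom ≫ hMor f Z.base)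
    (etMor.comp_mem _ _ (finEtMor_le_etMor _ Z.cover.prop) ((etBaseChange f).obj Z.base).prop)
  map {Z' Z} a := MorphismProperty.Over.homMk a.coverHom (by
    change a.coverHom ≫ Z.cover.hom ≫ hMor f Z.base = Z'.cover.hom ≫ hMor f Z'.base
    rw [reassoc_of% a.w, MorphismProperty.Over.w])
  map_id _ := rfl
  map_comp _ _ := rfl

/-- Vertical families: families `(V_i ⟶ U) ⟶ (V ⟶ U)` inducing the identity on `U`, such that
`(V_i ⟶ V)` is a covering of the site of finite étale `U_Y`-schemes. -/
inductive VerticalCovering : ∀ {Z : FaltingsSite f}, Presieve Z → Prop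
  | mk (U : Et X) (V : FEt (UY f U)) (R : Presieve V)
      (hR : Sieve.generate R ∈ fetTopology (UY f U) V) : VerticalCovering (R.map (alpha f U))

/-- Cartesian families: families `(V_i ⟶ U_i) ⟶ (V ⟶ U)` such that `(U_i ⟶ U)` is an étale
covering and such that `V_i ⟶ U_i ×_U V` is an isomorphism for all `i`. -/
structure CartesianCovering {Z : FaltingsSite f} (R : Presieve Z) : Prop where
  base_mem : Sieve.generate (R.map (siteProj f)) ∈ etTopology X ((siteProj f).obj Z)
  isPullback : ∀ ⦃Z' : FaltingsSite f⦄ ⦃a : Z' ⟶ Z⦄, R a →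
    IsPullback a.coverHom Z'.cover.hom Z.cover.hom (gY f a.baseHom)

/-- The vertical and the cartesian families, which generate the co-evanescent topology. -/
def coevanescentPrecoverage : Precoverage (FaltingsSite f) where
  coverings _ := {R | VerticalCovering f R ∨ CartesianCovering f R}

/-- The co-evanescent topology on the Faltings site. -/
def coevanescentTopology : GrothendieckTopology (FaltingsSite f) :=
  (coevanescentPrecoverage f).toGrothendieck

/-- The objects `V ⟶ U` such that `U` is of finite presentation over `X`. -/
def isCoh : ObjectProperty (FaltingsSite f) := fun Z =>
  LocallyOfFinitePresentation Z.base.hom ∧ QuasiCompact Z.base.hom ∧ QuasiSeparated Z.base.hom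

/-- The full subcategory of the Faltings site whose objects are the `V ⟶ U` such that `U` is of
finite presentation over `X`. -/
abbrev FaltingsSiteCoh : Type (u + 1) := (isCoh f).FullSubcategory

/-- The inclusion functor. -/
abbrev cohIncl : FaltingsSiteCoh f ⥤ FaltingsSite f := (isCoh f).ι

/-- The co-evanescent topology on the subcategory of the `V ⟶ U` such that `U` is of finite
presentation over `X`: it is generated by the vertical and the cartesian families
whose members belong to this subcategory. -/
def cohTopology : GrothendieckTopology (FaltingsSiteCoh f) :=
  ((coevanescentPrecoverage f).comap (cohIncl f)).toGrothendieck

/-- `X` as an étale `X`-scheme. -/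
abbrev etSelf (X : Scheme.{u}) : Et X := MorphismProperty.Over.mk ⊤ (𝟙 X) (etMor.id_mem X)

/-- `β⁺ : V ↦ (V ⟶ X)`, where `V` is identified to the finite étale scheme `V ×_Y X_Y` over
`X_Y = X ×_X Y ≅ Y`. -/
abbrev betaPlus : FEt Y ⥤ FaltingsSite f :=
  fetBaseChange (hMor f (etSelf X)) ⋙ alpha f (etSelf X)

/-! ### Continuity of the functors -/

lemma coevanescentTopology_le_of {J : GrothendieckTopology (FaltingsSite f)}
    (h₁ : ∀ (U : Et X) (V : FEt (UY f U)) (R : Presieve V),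
      Sieve.generate R ∈ fetTopology (UY f U) V → Sieve.generate (R.map (alpha f U)) ∈ J _)
    (h₂ : ∀ (Z : FaltingsSite f) (R : Presieve Z), CartesianCovering f R →
      Sieve.generate R ∈ J Z) : coevanescentTopology f ≤ J := by
  unfold coevanescentTopology
  rw [Precoverage.toGrothendieck_le_iff_le_toPrecoverage]
  rintro Z R (⟨U, V, R, hR⟩ | hR)
  · exact h₁ U V R hR
  · exact h₂ Z R hR

instance (U : Et X) :
    (alpha f U).IsContinuous (fetTopology (UY f U)) (coevanescentTopology f) := by
  apply Functor.isContinuous_of_coverPreserving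
  · constructor
    intro G Z T x hx V₁ V₂ W f₁ f₂ g₁ g₂ hg₁ hg₂ e
    have e₁ : f₁.baseHom = f₂.baseHom :=
      (Category.comp_id _).symm.trans ((congrArg FaltingsSite.Hom.baseHom e).trans
        (Category.comp_id _))
    have e₂ : f₁.coverHom ≫ g₁.left = f₂.coverHom ≫ g₂.left :=
      congrArg FaltingsSite.Hom.coverHom e
    let k : W ⟶ (alpha f U).obj (fiberProd g₁ g₂) :=
      ⟨f₁.baseHom, fiberProd.lift g₁ g₂ f₁.coverHom f₂.coverHom e₂,
        (fiberProd.lift_hom _ _ _ _ _).trans f₁.w⟩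
    have k₁ : k ≫ (alpha f U).map (fiberProd.fst g₁ g₂) = f₁ :=
      FaltingsSite.hom_ext (Category.comp_id _) (fiberProd.lift_fst _ _ _ _ _)
    have k₂ : k ≫ (alpha f U).map (fiberProd.snd g₁ g₂) = f₂ :=
      FaltingsSite.hom_ext ((Category.comp_id _).trans e₁) (fiberProd.lift_snd _ _ _ _ _)
    rw [← k₁, ← k₂, op_comp, op_comp, G.obj.map_comp, G.obj.map_comp]
    exact congrArg (G.obj.map k.op) (hx _ _ hg₁ hg₂ (fiberProd.condition g₁ g₂))
  · constructor
    intro V S hS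
    have hS' : Sieve.generate S.arrows ∈ fetTopology (UY f U) V := by rwa [Sieve.generate_sieve]
    have h := Precoverage.generate_mem_toGrothendieck (J := coevanescentPrecoverage f)
      (Or.inl (VerticalCovering.mk U V S.arrows hS'))
    rwa [Sieve.generate_map_eq_functorPushforward, Sieve.generate_sieve] at h

instance : (betaPlus f).IsContinuous (fetTopology Y) (coevanescentTopology f) :=
  Functor.isContinuous_comp _ _ _ (fetTopology _) _

lemma exists_lift_cover {Z Z₁ Z₂ : FaltingsSite f} (g₁ : Z₁ ⟶ Z) (g₂ : Z₂ ⟶ Z) {T : Scheme.{u}}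
    (t₁ : T ⟶ Z₁.cover.left) (t₂ : T ⟶ Z₂.cover.left) (ht : t₁ ≫ g₁.coverHom = t₂ ≫ g₂.coverHom) :
    ∃ (W : FaltingsSite f) (p₁ : W ⟶ Z₁) (p₂ : W ⟶ Z₂) (k : T ⟶ W.cover.left),
      p₁ ≫ g₁ = p₂ ≫ g₂ ∧ k ≫ p₁.coverHom = t₁ ∧ k ≫ p₂.coverHom = t₂ := by
  let U := fiberProd g₁.baseHom g₂.baseHom
  let q₁ : U ⟶ Z₁.base := fiberProd.fst g₁.baseHom g₂.baseHom
  let q₂ : U ⟶ Z₂.base := fiberProd.snd g₁.baseHom g₂.baseHom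
  have hq : q₁ ≫ g₁.baseHom = q₂ ≫ g₂.baseHom := fiberProd.condition g₁.baseHom g₂.baseHom
  let V₀ := (fetBaseChange (gY f (q₁ ≫ g₁.baseHom))).obj Z.cover
  let V₁ := (fetBaseChange (gY f q₁)).obj Z₁.cover
  let V₂ := (fetBaseChange (gY f q₂)).obj Z₂.cover
  let b₁ : V₁ ⟶ V₀ := bcLift (bcFst (gY f q₁) Z₁.cover ≫ g₁.coverHom) (by
    rw [Category.assoc, g₁.w, ← Category.assoc, bcFst_w, gY_comp, Category.assoc])
  let b₂ : V₂ ⟶ V₀ := bcLift (bcFst (gY f q₂) Z₂.cover ≫ g₂.coverHom) (by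
    rw [Category.assoc, g₂.w, ← Category.assoc, bcFst_w, hq, gY_comp, Category.assoc])
  have hb₁ : b₁.left ≫ bcFst _ Z.cover = bcFst (gY f q₁) Z₁.cover ≫ g₁.coverHom := bcLift_fst _ _
  have hb₂ : b₂.left ≫ bcFst _ Z.cover = bcFst (gY f q₂) Z₂.cover ≫ g₂.coverHom := bcLift_fst _ _
  let W : FaltingsSite f := ⟨U, fiberProd b₁ b₂⟩
  let p₁ : W ⟶ Z₁ := ⟨q₁, (fiberProd.fst b₁ b₂).left ≫ bcFst (gY f q₁) Z₁.cover, by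
    rw [Category.assoc, bcFst_w]
    exact MorphismProperty.Over.w_assoc (fiberProd.fst b₁ b₂) _⟩
  let p₂ : W ⟶ Z₂ := ⟨q₂, (fiberProd.snd b₁ b₂).left ≫ bcFst (gY f q₂) Z₂.cover, by
    rw [Category.assoc, bcFst_w]
    exact MorphismProperty.Over.w_assoc (fiberProd.snd b₁ b₂) _⟩
  have hp : p₁ ≫ g₁ = p₂ ≫ g₂ := by
    refine FaltingsSite.hom_ext hq ?_
    change ((fiberProd.fst b₁ b₂).left ≫ bcFst (gY f q₁) Z₁.cover) ≫ g₁.coverHom =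
      ((fiberProd.snd b₁ b₂).left ≫ bcFst (gY f q₂) Z₂.cover) ≫ g₂.coverHom
    rw [Category.assoc, Category.assoc, ← hb₁, ← hb₂, ← Category.assoc, ← Category.assoc]
    exact congrArg (fun a : fiberProd b₁ b₂ ⟶ V₀ => a.left ≫ bcFst _ Z.cover)
      (fiberProd.condition b₁ b₂)
  have h₁ := g₁.w
  have h₂ := g₂.w
  have ht' : t₁ ≫ Z₁.cover.hom ≫ hMor f Z₁.base = t₂ ≫ Z₂.cover.hom ≫ hMor f Z₂.base := by
    rw [← gY_h f g₁.baseHom, ← gY_h f g₂.baseHom, ← reassoc_of% h₁, ← reassoc_of% h₂,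
      reassoc_of% ht]
  let c₀ : T ⟶ U.left := fiberProd.lift g₁.baseHom g₂.baseHom
    (t₁ ≫ Z₁.cover.hom ≫ bcFst f Z₁.base) (t₂ ≫ Z₂.cover.hom ≫ bcFst f Z₂.base) (by
      have e₁ := bcMap_fst f g₁.baseHom
      have e₂ := bcMap_fst f g₂.baseHom
      simp only [Category.assoc]
      rw [← e₁, ← e₂, ← reassoc_of% h₁, ← reassoc_of% h₂, reassoc_of% ht])
  let c : T ⟶ UY f U := bcPair c₀ (t₁ ≫ Z₁.cover.hom ≫ hMor f Z₁.base) (by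
    rw [fiberProd.lift_hom, Category.assoc, Category.assoc, bcFst_w]
    simp only [Category.assoc])
  have hc₁ : t₁ ≫ Z₁.cover.hom = c ≫ gY f q₁ := by
    refine bc_ext ?_ ?_
    · rw [Category.assoc, Category.assoc, bcMap_fst, ← Category.assoc c, bcPair_fst,
        fiberProd.lift_fst]
    · rw [Category.assoc, Category.assoc, MorphismProperty.Over.w, bcPair_hom]
  have hc₂ : t₂ ≫ Z₂.cover.hom = c ≫ gY f q₂ := by
    refine bc_ext ?_ ?_
    · rw [Category.assoc, Category.assoc, bcMap_fst, ← Category.assoc c, bcPair_fst,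
        fiberProd.lift_snd]
    · rw [Category.assoc, Category.assoc, MorphismProperty.Over.w, bcPair_hom, ht']
  let k₀ : T ⟶ (fiberProd b₁ b₂).left :=
    fiberProd.lift b₁ b₂ (bcPair t₁ c hc₁) (bcPair t₂ c hc₂) (by
      refine bc_ext ?_ ?_
      · rw [Category.assoc, Category.assoc, hb₁, hb₂, ← Category.assoc, ← Category.assoc,
          bcPair_fst, bcPair_fst, ht]
      · rw [Category.assoc, Category.assoc, MorphismProperty.Over.w, MorphismProperty.Over.w,
          bcPair_hom, bcPair_hom])
  refine ⟨W, p₁, p₂, k₀, hp, ?_, ?_⟩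
  · change k₀ ≫ (fiberProd.fst b₁ b₂).left ≫ bcFst (gY f q₁) Z₁.cover = t₁
    rw [← Category.assoc, fiberProd.lift_fst, bcPair_fst]
  · change k₀ ≫ (fiberProd.snd b₁ b₂).left ≫ bcFst (gY f q₂) Z₂.cover = t₂
    rw [← Category.assoc, fiberProd.lift_snd, bcPair_fst]

lemma exists_lift_psiPlus {Z Z₁ Z₂ : FaltingsSite f} (g₁ : Z₁ ⟶ Z) (g₂ : Z₂ ⟶ Z) {T : Et Y}
    (t₁ : T ⟶ (psiPlus f).obj Z₁) (t₂ : T ⟶ (psiPlus f).obj Z₂)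
    (e : t₁ ≫ (psiPlus f).map g₁ = t₂ ≫ (psiPlus f).map g₂) :
    ∃ (W : FaltingsSite f) (p₁ : W ⟶ Z₁) (p₂ : W ⟶ Z₂) (k : T ⟶ (psiPlus f).obj W),
      p₁ ≫ g₁ = p₂ ≫ g₂ ∧ k ≫ (psiPlus f).map p₁ = t₁ ∧ k ≫ (psiPlus f).map p₂ = t₂ := by
  obtain ⟨W, p₁, p₂, k, h, h₁, h₂⟩ := exists_lift_cover f g₁ g₂ t₁.left t₂.left
    (congrArg (fun a : T ⟶ (psiPlus f).obj Z => a.left) e)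
  have hk : k ≫ ((psiPlus f).obj W).hom = T.hom :=
    (congrArg (k ≫ ·) (MorphismProperty.Over.w ((psiPlus f).map p₁)).symm).trans
      ((Category.assoc _ _ _).symm.trans ((congrArg (· ≫ ((psiPlus f).obj Z₁).hom) h₁).trans
        (MorphismProperty.Over.w t₁)))
  exact ⟨W, p₁, p₂, MorphismProperty.Over.homMk k hk, h, MorphismProperty.Over.Hom.ext h₁,
    MorphismProperty.Over.Hom.ext h₂⟩

lemma surjective_pullback {Z W : FaltingsSite f} (S : Sieve Z) (a : W ⟶ Z)
    (hS : ∀ v : Z.cover.left, ∃ (Z' : FaltingsSite f) (b : Z' ⟶ Z) (v' : Z'.cover.left),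
      S b ∧ b.coverHom v' = v) (w : W.cover.left) :
    ∃ (Z' : FaltingsSite f) (b : Z' ⟶ W) (v' : Z'.cover.left),
      S (b ≫ a) ∧ b.coverHom v' = w := by
  obtain ⟨Z', b, v', hb, e⟩ := hS (a.coverHom w)
  let a' := (psiPlus f).map a
  let b' := (psiPlus f).map b
  obtain ⟨z, hz, -⟩ := Scheme.Pullback.exists_preimage_pullback (f := a'.left) (g := b'.left) w v'
    e.symm
  obtain ⟨W', p, q, k, h₁, h₂, h₃⟩ := exists_lift_psiPlus f a b (fiberProd.fst a' b')
    (fiberProd.snd a' b') (fiberProd.condition a' b')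
  refine ⟨W', p, k.left z, ?_, ?_⟩
  · rw [h₁]
    exact S.downward_closed hb _
  · exact (congrArg (fun t : fiberProd a' b' ⟶ (psiPlus f).obj W => t.left z) h₂).trans hz

lemma coevanescentTopology_surjective {Z : FaltingsSite f} (R : Presieve Z)
    (hR : R ∈ coevanescentPrecoverage f Z) (v : Z.cover.left) :
    ∃ (Z' : FaltingsSite f) (b : Z' ⟶ Z) (v' : Z'.cover.left),
      Sieve.generate R b ∧ b.coverHom v' = v := by
  obtain (⟨U, V, R, hR⟩ | hR) := hR
  · rw [mem_fetTopology] at hR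
    obtain ⟨W, g, w, ⟨W', b, c, hc, rfl⟩, rfl⟩ := hR v
    exact ⟨_, (alpha f U).map c, b.left w, Sieve.le_generate _ _ _ ⟨hc⟩, rfl⟩
  · have h := hR.base_mem
    rw [mem_etTopology] at h
    obtain ⟨U', g, u, ⟨U'', b, _, ⟨hc⟩, rfl⟩, e⟩ := h (bcFst f Z.base (Z.cover.hom v))
    rename_i Z' c
    obtain ⟨y, -, hy⟩ := Scheme.exists_preimage_of_isPullback (bcMap_isPullback f c.baseHom)
      (b.left u) (Z.cover.hom v) e
    obtain ⟨v', hv', -⟩ := Scheme.exists_preimage_of_isPullback (hR.isPullback hc) v y hy.symm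
    exact ⟨_, c, v', Sieve.le_generate _ _ _ hc, hv'⟩

instance : (psiPlus f).IsContinuous (coevanescentTopology f) (etTopology Y) := by
  rw [← Functor.le_inducedTopology_iff]
  unfold coevanescentTopology
  rw [Precoverage.toGrothendieck_le_iff_le_toPrecoverage]
  intro Z R hR
  apply Sheaf.mem_finestTopology_of_forall_isSheafFor
  rintro - ⟨G, rfl⟩ W a
  apply isSheafFor_of_functorPushforward_mem
  · constructor
    intro G Z T x hx Z₁ Z₂ W t₁ t₂ g₁ g₂ hg₁ hg₂ e
    obtain ⟨W', p₁, p₂, k, hp, rfl, rfl⟩ := exists_lift_psiPlus f g₁ g₂ t₁ t₂ e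
    rw [op_comp, op_comp, G.obj.map_comp, G.obj.map_comp]
    exact congrArg (G.obj.map k.op) (hx _ _ hg₁ hg₂ hp)
  · rw [mem_etTopology]
    intro w
    obtain ⟨Z', b, v', hb, e⟩ := surjective_pullback f (Sieve.generate R) a
      (coevanescentTopology_surjective f R hR) w
    exact ⟨_, (psiPlus f).map b, v',
      Sieve.image_mem_functorPushforward (psiPlus f) (Sieve.pullback a (Sieve.generate R)) hb, e⟩

/-! ### Direct images -/

/-- The direct image of sheaves of sets by the morphism of finite étale topoi defined by
`g : B ⟶ A`. -/
abbrev fetPush {A B : Scheme.{u}} (g : B ⟶ A) :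
    Sheaf (fetTopology B) (Type u) ⥤ Sheaf (fetTopology A) (Type u) :=
  (fetBaseChange g).sheafPushforwardContinuous (Type u) (fetTopology A) (fetTopology B)

/-- The direct image functor `ρ_*` from the étale topos to the finite étale topos of `Y`. -/
abbrev rhoPush (Y : Scheme.{u}) :
    Sheaf (etTopology Y) (Type u) ⥤ Sheaf (fetTopology Y) (Type u) :=
  (fetToEt Y).sheafPushforwardContinuous (Type u) (fetTopology Y) (etTopology Y)

/-- The direct image functor `β_*` from the Faltings topos to the finite étale topos of `Y`. -/
abbrev betaPush :
    Sheaf (coevanescentTopology f) (Type u) ⥤ Sheaf (fetTopology Y) (Type u) :=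
  (betaPlus f).sheafPushforwardContinuous (Type u) (fetTopology Y) (coevanescentTopology f)

/-- The direct image functor `Ψ_*` from the étale topos of `Y` to the Faltings topos. -/
abbrev psiPush :
    Sheaf (etTopology Y) (Type u) ⥤ Sheaf (coevanescentTopology f) (Type u) :=
  (psiPlus f).sheafPushforwardContinuous (Type u) (coevanescentTopology f) (etTopology Y)

/-- The functor sending a sheaf `G` on the Faltings site to the sheaf `V ↦ G(V ⟶ U)` on the site of
finite étale `U_Y`-schemes. -/
abbrev alphaPush (U : Et X) :
    Sheaf (coevanescentTopology f) (Type u) ⥤ Sheaf (fetTopology (UY f U)) (Type u) :=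
  (alpha f U).sheafPushforwardContinuous (Type u) (fetTopology (UY f U)) (coevanescentTopology f)

/-! ### The presheaf of the inverse images -/

/-- The canonical morphism `(W ×_A B) ×_B C ⟶ W ×_A C`. -/
def bcCompApp {A B C : Scheme.{u}} {p : B ⟶ A} {q : C ⟶ B} {r : C ⟶ A} (h : q ≫ p = r)
    (W : FEt A) : (fetBaseChange q).obj ((fetBaseChange p).obj W) ⟶ (fetBaseChange r).obj W :=
  bcLift (bcFst q ((fetBaseChange p).obj W) ≫ bcFst p W) (by
    subst h
    rw [Category.assoc, bcFst_w, ← Category.assoc, bcFst_w, Category.assoc])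

lemma bcCompApp_fst {A B C : Scheme.{u}} {p : B ⟶ A} {q : C ⟶ B} {r : C ⟶ A} (h : q ≫ p = r)
    (W : FEt A) :
    (bcCompApp h W).left ≫ bcFst r W = bcFst q ((fetBaseChange p).obj W) ≫ bcFst p W :=
  bcLift_fst _ _

/-- The canonical morphisms `(W ×_A B) ×_B C ⟶ W ×_A C`, as a natural transformation. -/
def bcComp {A B C : Scheme.{u}} {p : B ⟶ A} {q : C ⟶ B} {r : C ⟶ A} (h : q ≫ p = r) :
    fetBaseChange p ⋙ fetBaseChange q ⟶ fetBaseChange r where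
  app W := bcCompApp h W
  naturality W' W m := by
    apply bc_hom_ext
    change (((fetBaseChange q).map ((fetBaseChange p).map m)).left ≫ (bcCompApp h W).left) ≫ _ =
      ((bcCompApp h W').left ≫ ((fetBaseChange r).map m).left) ≫ _
    rw [Category.assoc, Category.assoc, bcMap_fst, bcCompApp_fst, ← Category.assoc, bcMap_fst,
      Category.assoc, bcMap_fst, ← Category.assoc (bcCompApp h W').left, bcCompApp_fst,
      Category.assoc]

/-- The canonical morphism `V ⟶ V ×_A A`. -/
def bcIdApp {A : Scheme.{u}} {q : A ⟶ A} (h : q = 𝟙 A) (V : FEt A) :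
    V ⟶ (fetBaseChange q).obj V :=
  bcLift (𝟙 V.left) (by subst h; exact (Category.id_comp _).trans (Category.comp_id _).symm)

lemma bcIdApp_fst {A : Scheme.{u}} {q : A ⟶ A} (h : q = 𝟙 A) (V : FEt A) :
    (bcIdApp h V).left ≫ bcFst q V = 𝟙 V.left :=
  bcLift_fst _ _

/-- The canonical morphisms `V ⟶ V ×_A A`, as a natural transformation. -/
def bcId {A : Scheme.{u}} {q : A ⟶ A} (h : q = 𝟙 A) : 𝟭 (FEt A) ⟶ fetBaseChange q where
  app V := bcIdApp h V
  naturality V' V m := by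
    apply bc_hom_ext
    change (m.left ≫ (bcIdApp h V).left) ≫ _ =
      ((bcIdApp h V').left ≫ ((fetBaseChange q).map m).left) ≫ _
    rw [Category.assoc, Category.assoc, bcMap_fst, bcIdApp_fst, ← Category.assoc, bcIdApp_fst,
      Category.id_comp, Category.comp_id]

/-- The canonical morphism `r_* ⟶ p_* q_*`, for `r = p ∘ q`. -/
def pushComp {A B C : Scheme.{u}} {p : B ⟶ A} {q : C ⟶ B} {r : C ⟶ A} (h : q ≫ p = r) :
    fetPush r ⟶ fetPush q ⋙ fetPush p where
  app G := ⟨Functor.whiskerRight (NatTrans.op (bcComp h)) G.obj⟩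
  naturality G' G m := by
    ext W x
    exact (ConcreteCategory.congr_hom (m.hom.naturality ((bcComp h).app W.unop).op) x).symm

section InverseImage

variable (L : ∀ U : Et X, Sheaf (fetTopology Y) (Type u) ⥤ Sheaf (fetTopology (UY f U)) (Type u))
  (adj : ∀ U : Et X, L U ⊣ fetPush (hMor f U)) (F : Sheaf (fetTopology Y) (Type u))

variable {f L}

/-- For an `X`-morphism `g : U' ⟶ U`, the morphism from `(h_U)^* F` to the direct image of
`(h_{U'})^* F` by `U'_Y ⟶ U_Y` which is adjoint to the canonical isomorphism. -/
def transition {U' U : Et X} (g : U' ⟶ U) :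
    (L U).obj F ⟶ (fetPush (gY f g)).obj ((L U').obj F) :=
  ((adj U).homEquiv _ _).symm
    ((adj U').unit.app F ≫ (pushComp (gY_h f g)).app ((L U').obj F))

/-- The maps `F(W) ⟶ ((h_U)^* F)(W ×_Y U_Y)` given by the unit of the adjunction. -/
def unitApp (U : Et X) (W : FEt Y) :
    F.obj.obj (op W) ⟶ ((L U).obj F).obj.obj (op ((fetBaseChange (hMor f U)).obj W)) :=
  ((adj U).unit.app F).hom.app (op W)

/-- The maps `((h_U)^* F)(V) ⟶ ((h_{U'})^* F)(V ×_{U_Y} U'_Y)` given by `transition`. -/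
def transitionApp {U' U : Et X} (g : U' ⟶ U) (V : FEt (UY f U)) :
    ((L U).obj F).obj.obj (op V) ⟶
      ((L U').obj F).obj.obj (op ((fetBaseChange (gY f g)).obj V)) :=
  (transition adj F g).hom.app (op V)

lemma transitionApp_naturality {U' U : Et X} (g : U' ⟶ U) {V' V : FEt (UY f U)} (m : V' ⟶ V) :
    ((L U).obj F).obj.map m.op ≫ transitionApp adj F g V' =
      transitionApp adj F g V ≫ ((L U').obj F).obj.map ((fetBaseChange (gY f g)).map m).op :=
  (transition adj F g).hom.naturality m.op

lemma invImage_hom_ext {U : Et X} {G : Sheaf (fetTopology (UY f U)) (Type u)}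
    {m n : (L U).obj F ⟶ G}
    (h : ∀ W : FEt Y,
      unitApp adj F U W ≫ m.hom.app (op ((fetBaseChange (hMor f U)).obj W)) =
        unitApp adj F U W ≫ n.hom.app (op ((fetBaseChange (hMor f U)).obj W))) : m = n := by
  apply ((adj U).homEquiv _ _).injective
  rw [Adjunction.homEquiv_unit, Adjunction.homEquiv_unit]
  ext W x
  exact ConcreteCategory.congr_hom (h W.unop) x

lemma unitApp_transitionApp {U' U : Et X} (g : U' ⟶ U) (W : FEt Y) :
    unitApp adj F U W ≫ transitionApp adj F g ((fetBaseChange (hMor f U)).obj W) =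
      unitApp adj F U' W ≫ ((L U').obj F).obj.map (bcCompApp (gY_h f g) W).op := by
  have h : (adj U).unit.app F ≫ (fetPush (hMor f U)).map (transition adj F g) = _ :=
    ((adj U).homEquiv_unit _ _ _).symm.trans (((adj U).homEquiv _ _).apply_symm_apply _)
  exact congrArg (fun m => m.hom.app (op W)) h

lemma transition_id (U : Et X) (V : FEt (UY f U)) :
    transitionApp adj F (𝟙 U) V ≫ ((L U).obj F).obj.map (bcIdApp (gY_id f U) V).op = 𝟙 _ := by
  let G := (L U).obj F
  let m : G ⟶ G := transition adj F (𝟙 U) ≫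
    (⟨Functor.whiskerRight (NatTrans.op (bcId (gY_id f U))) G.obj⟩ :
      (fetPush (gY f (𝟙 U))).obj G ⟶ G)
  have hm : m = 𝟙 G := by
    refine invImage_hom_ext adj F fun W => ?_
    change _ ≫ transitionApp adj F (𝟙 U) _ ≫ ((L U).obj F).obj.map (bcIdApp (gY_id f U) _).op =
      _ ≫ 𝟙 _
    rw [← Category.assoc, unitApp_transitionApp, Category.assoc, ← Functor.map_comp, ← op_comp]
    have h : bcIdApp (gY_id f U) ((fetBaseChange (hMor f U)).obj W) ≫
        bcCompApp (gY_h f (𝟙 U)) W = 𝟙 _ := by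
      apply bc_hom_ext
      change ((bcIdApp (gY_id f U) _).left ≫ (bcCompApp (gY_h f (𝟙 U)) W).left) ≫ _ = 𝟙 _ ≫ _
      rw [Category.assoc, bcCompApp_fst, ← Category.assoc, bcIdApp_fst]
    rw [h, op_id, CategoryTheory.Functor.map_id]
  exact congrArg (fun m => m.hom.app (op V)) hm

lemma transition_comp {U'' U' U : Et X} (g' : U'' ⟶ U') (g : U' ⟶ U) (V : FEt (UY f U)) :
    transitionApp adj F (g' ≫ g) V ≫
        ((L U'').obj F).obj.map (bcCompApp (gY_comp f g' g).symm V).op =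
      transitionApp adj F g V ≫ transitionApp adj F g' ((fetBaseChange (gY f g)).obj V) := by
  have hm : transition adj F (g' ≫ g) ≫ (pushComp (gY_comp f g' g).symm).app _ =
      transition adj F g ≫ (fetPush (gY f g)).map (transition adj F g') := by
    refine invImage_hom_ext adj F fun W => ?_
    change _ ≫ transitionApp adj F (g' ≫ g) _ ≫
        ((L U'').obj F).obj.map (bcCompApp (gY_comp f g' g).symm _).op =
      _ ≫ transitionApp adj F g _ ≫ transitionApp adj F g' _
    rw [← Category.assoc, ← Category.assoc, unitApp_transitionApp, unitApp_transitionApp,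
      Category.assoc, Category.assoc, transitionApp_naturality, reassoc_of% unitApp_transitionApp, ← Functor.map_comp, ← Functor.map_comp, ← op_comp,
      ← op_comp]
    congr 3
    apply bc_hom_ext
    change ((bcCompApp (gY_comp f g' g).symm _).left ≫ (bcCompApp (gY_h f (g' ≫ g)) W).left) ≫ _ =
      (((fetBaseChange (gY f g')).map (bcCompApp (gY_h f g) W)).left ≫
        (bcCompApp (gY_h f g') W).left) ≫ _
    rw [Category.assoc, Category.assoc, bcCompApp_fst, bcCompApp_fst, ← Category.assoc,
      ← Category.assoc, bcCompApp_fst, bcMap_fst, Category.assoc, Category.assoc, bcCompApp_fst]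
  exact congrArg (fun m => m.hom.app (op V)) hm

lemma bcLift_comp {Z'' Z' Z : FaltingsSite f} (b : Z'' ⟶ Z') (a : Z' ⟶ Z) :
    (bcLift (b.coverHom ≫ a.coverHom) (b ≫ a).w :
        Z''.cover ⟶ (fetBaseChange (gY f (b.baseHom ≫ a.baseHom))).obj Z.cover) =
      bcLift b.coverHom b.w ≫ (fetBaseChange (gY f b.baseHom)).map (bcLift a.coverHom a.w) ≫
        bcCompApp (gY_comp f b.baseHom a.baseHom).symm Z.cover := by
  apply bc_hom_ext
  refine (bcLift_fst (V := Z.cover) (f := gY f (b.baseHom ≫ a.baseHom)) _ _).trans ?_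
  change _ = ((bcLift (V := Z'.cover) b.coverHom b.w).left ≫
    ((fetBaseChange (gY f b.baseHom)).map (bcLift (V := Z.cover) a.coverHom a.w)).left ≫
      (bcCompApp (gY_comp f b.baseHom a.baseHom).symm Z.cover).left) ≫ _
  rw [Category.assoc, Category.assoc, bcCompApp_fst, reassoc_of% bcMap_fst, bcLift_fst,
    ← Category.assoc, bcLift_fst]

/-- The presheaf `(V ⟶ U) ↦ ((h_U)^* F)(V)` on the Faltings site. -/
def invImagePresheaf : (FaltingsSite f)ᵒᵖ ⥤ Type u where
  obj Z := ((L Z.unop.base).obj F).obj.obj (op Z.unop.cover)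
  map {Z Z'} a := transitionApp adj F a.unop.baseHom Z.unop.cover ≫
    ((L Z'.unop.base).obj F).obj.map (bcLift a.unop.coverHom a.unop.w).op
  map_id Z := transition_id adj F Z.unop.base Z.unop.cover
  map_comp {Z Z' Z''} a b := by
    change transitionApp adj F (b.unop.baseHom ≫ a.unop.baseHom) Z.unop.cover ≫
        ((L Z''.unop.base).obj F).obj.map (bcLift (b.unop.coverHom ≫ a.unop.coverHom)
          (b.unop ≫ a.unop).w).op =
      (transitionApp adj F a.unop.baseHom Z.unop.cover ≫
        ((L Z'.unop.base).obj F).obj.map (bcLift a.unop.coverHom a.unop.w).op) ≫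
      transitionApp adj F b.unop.baseHom Z'.unop.cover ≫
        ((L Z''.unop.base).obj F).obj.map (bcLift b.unop.coverHom b.unop.w).op
    have h := bcLift_comp b.unop a.unop
    rw [h, op_comp, op_comp, Functor.map_comp, Functor.map_comp, ← Category.assoc,
      ← Category.assoc, transition_comp]
    simp only [Category.assoc]
    rw [← reassoc_of% transitionApp_naturality]

end InverseImage

/-! ### The canonical morphism -/

/-- The morphism `W ×_Y U'_Y ⟶ W ×_Y U_Y` induced by `U' ⟶ U`. -/
def baseMapLeft {U' U : Et X} (g : U' ⟶ U) (W : FEt Y) :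
    ((fetBaseChange (hMor f U')).obj W).left ⟶ ((fetBaseChange (hMor f U)).obj W).left :=
  bcPair (bcFst (hMor f U') W) (((fetBaseChange (hMor f U')).obj W).hom ≫ gY f g) (by
    rw [Category.assoc, gY_h, bcFst_w])

lemma baseMapLeft_fst {U' U : Et X} (g : U' ⟶ U) (W : FEt Y) :
    baseMapLeft f g W ≫ bcFst (hMor f U) W = bcFst (hMor f U') W :=
  bcPair_fst _ _ _

lemma baseMapLeft_hom {U' U : Et X} (g : U' ⟶ U) (W : FEt Y) :
    baseMapLeft f g W ≫ ((fetBaseChange (hMor f U)).obj W).hom =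
      ((fetBaseChange (hMor f U')).obj W).hom ≫ gY f g :=
  bcPair_hom _ _ _

/-- The morphism `(W ×_Y U'_Y ⟶ U') ⟶ (W ×_Y U_Y ⟶ U)` induced by `U' ⟶ U`. -/
def baseMapApp {U' U : Et X} (g : U' ⟶ U) (W : FEt Y) :
    (alpha f U').obj ((fetBaseChange (hMor f U')).obj W) ⟶
      (alpha f U).obj ((fetBaseChange (hMor f U)).obj W) :=
  ⟨g, baseMapLeft f g W, baseMapLeft_hom f g W⟩

/-- The structural morphism `U ⟶ X`. -/
def toSelf (U : Et X) : U ⟶ etSelf X :=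
  MorphismProperty.Over.homMk U.hom (Category.comp_id _)

lemma comp_toSelf {U' U : Et X} (g : U' ⟶ U) : g ≫ toSelf U = toSelf U' :=
  MorphismProperty.Over.Hom.ext (MorphismProperty.Over.w g)

lemma baseMapApp_comp {U'' U' U : Et X} (g' : U'' ⟶ U') (g : U' ⟶ U) (W : FEt Y) :
    baseMapApp f g' W ≫ baseMapApp f g W = baseMapApp f (g' ≫ g) W := by
  refine FaltingsSite.hom_ext rfl ?_
  change baseMapLeft f g' W ≫ baseMapLeft f g W = baseMapLeft f (g' ≫ g) W
  refine bc_ext ?_ ?_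
  · rw [Category.assoc, baseMapLeft_fst, baseMapLeft_fst, baseMapLeft_fst]
  · rw [Category.assoc, baseMapLeft_hom, ← Category.assoc, baseMapLeft_hom, baseMapLeft_hom,
      gY_comp, Category.assoc]

/-- The morphisms `(W ×_Y U_Y ⟶ U) ⟶ β⁺(W)`, as a natural transformation. -/
def alphaToBeta (U : Et X) : fetBaseChange (hMor f U) ⋙ alpha f U ⟶ betaPlus f where
  app W := baseMapApp f (toSelf U) W
  naturality W' W m := by
    refine FaltingsSite.hom_ext ((Category.id_comp _).trans (Category.comp_id _).symm) ?_
    change ((fetBaseChange (hMor f U)).map m).left ≫ baseMapLeft f (toSelf U) W =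
      baseMapLeft f (toSelf U) W' ≫ ((fetBaseChange (hMor f (etSelf X))).map m).left
    refine bc_ext ?_ ?_
    · rw [Category.assoc, Category.assoc, baseMapLeft_fst, bcMap_fst, bcMap_fst,
        ← Category.assoc, baseMapLeft_fst]
    · rw [Category.assoc, Category.assoc, baseMapLeft_hom, MorphismProperty.Over.w, baseMapLeft_hom,
        ← Category.assoc, MorphismProperty.Over.w]

/-- The maps `G(β⁺(W)) ⟶ G(W ×_Y U_Y ⟶ U)`, as a morphism from `β_*` to the functor sending `G`
to the direct image by `h_U` of `V ↦ G(V ⟶ U)`. -/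
def betaToAlpha (U : Et X) : betaPush f ⟶ alphaPush f U ⋙ fetPush (hMor f U) where
  app G := ⟨Functor.whiskerRight (NatTrans.op (alphaToBeta f U)) G.obj⟩
  naturality G' G m := by
    ext W x
    exact (ConcreteCategory.congr_hom (m.hom.naturality ((alphaToBeta f U).app W.unop).op) x).symm

section CanonicalMorphism

variable {L : ∀ U : Et X,
    Sheaf (fetTopology Y) (Type u) ⥤ Sheaf (fetTopology (UY f U)) (Type u)}
  (adj : ∀ U : Et X, L U ⊣ fetPush (hMor f U))
  {βs : Sheaf (fetTopology Y) (Type u) ⥤ Sheaf (coevanescentTopology f) (Type u)}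
  (adjβ : βs ⊣ betaPush f) (F : Sheaf (fetTopology Y) (Type u))

variable {f}

/-- The morphism from `(h_U)^* F` to `V ↦ (β^* F)(V ⟶ U)` which is adjoint to the maps
`F(W) ⟶ (β^* F)(β⁺(W)) ⟶ (β^* F)(W ×_Y U_Y ⟶ U)`. -/
def invImageToBetaAt (U : Et X) : (L U).obj F ⟶ (alphaPush f U).obj (βs.obj F) :=
  ((adj U).homEquiv _ _).symm (adjβ.unit.app F ≫ (betaToAlpha f U).app (βs.obj F))

/-- The maps `((h_U)^* F)(V) ⟶ (β^* F)(V ⟶ U)`. -/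
def invImageToBetaApp (U : Et X) (V : FEt (UY f U)) :
    ((L U).obj F).obj.obj (op V) ⟶ (βs.obj F).obj.obj (op ((alpha f U).obj V)) :=
  (invImageToBetaAt adj adjβ F U).hom.app (op V)

lemma invImageToBetaApp_naturality (U : Et X) {V' V : FEt (UY f U)} (m : V' ⟶ V) :
    ((L U).obj F).obj.map m.op ≫ invImageToBetaApp adj adjβ F U V' =
      invImageToBetaApp adj adjβ F U V ≫ (βs.obj F).obj.map ((alpha f U).map m).op :=
  (invImageToBetaAt adj adjβ F U).hom.naturality m.op

/-- The maps `F(W) ⟶ (β^* F)(β⁺(W))` given by the unit of the adjunction. -/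
def betaUnitApp (W : FEt Y) :
    F.obj.obj (op W) ⟶ (βs.obj F).obj.obj (op ((betaPlus f).obj W)) :=
  (adjβ.unit.app F).hom.app (op W)

lemma unitApp_invImageToBetaApp (U : Et X) (W : FEt Y) :
    unitApp adj F U W ≫ invImageToBetaApp adj adjβ F U ((fetBaseChange (hMor f U)).obj W) =
      betaUnitApp adjβ F W ≫ (βs.obj F).obj.map (baseMapApp f (toSelf U) W).op := by
  have h : (adj U).unit.app F ≫ (fetPush (hMor f U)).map (invImageToBetaAt adj adjβ F U) = _ :=
    ((adj U).homEquiv_unit _ _ _).symm.trans (((adj U).homEquiv _ _).apply_symm_apply _)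
  exact congrArg (fun m => m.hom.app (op W)) h

/-- The morphism `(V ×_{U_Y} U'_Y ⟶ U') ⟶ (V ⟶ U)`. -/
def pullbackCoverApp {U' U : Et X} (g : U' ⟶ U) (V : FEt (UY f U)) :
    (alpha f U').obj ((fetBaseChange (gY f g)).obj V) ⟶ (alpha f U).obj V :=
  ⟨g, bcFst (gY f g) V, bcFst_w (gY f g) V⟩

/-- The morphisms `(V ×_{U_Y} U'_Y ⟶ U') ⟶ (V ⟶ U)`, as a natural transformation. -/
def pullbackCoverNat {U' U : Et X} (g : U' ⟶ U) :
    fetBaseChange (gY f g) ⋙ alpha f U' ⟶ alpha f U where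
  app V := pullbackCoverApp g V
  naturality _ _ m :=
    FaltingsSite.hom_ext ((Category.id_comp _).trans (Category.comp_id _).symm)
      (bcMap_fst (gY f g) m)

lemma transition_invImageToBetaApp {U' U : Et X} (g : U' ⟶ U) (V : FEt (UY f U)) :
    transitionApp adj F g V ≫
        invImageToBetaApp adj adjβ F U' ((fetBaseChange (gY f g)).obj V) =
      invImageToBetaApp adj adjβ F U V ≫ (βs.obj F).obj.map (pullbackCoverApp g V).op := by
  have hm : transition adj F g ≫
      (fetPush (gY f g)).map (invImageToBetaAt adj adjβ F U') =
      invImageToBetaAt adj adjβ F U ≫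
        (⟨Functor.whiskerRight (NatTrans.op (pullbackCoverNat g)) (βs.obj F).obj⟩ :
          (alphaPush f U).obj (βs.obj F) ⟶
            (fetPush (gY f g)).obj ((alphaPush f U').obj (βs.obj F))) := by
    refine invImage_hom_ext adj F fun W => ?_
    change _ ≫ transitionApp adj F g ((fetBaseChange (hMor f U)).obj W) ≫
        invImageToBetaApp adj adjβ F U' ((fetBaseChange (gY f g)).obj
          ((fetBaseChange (hMor f U)).obj W)) =
      _ ≫ invImageToBetaApp adj adjβ F U ((fetBaseChange (hMor f U)).obj W) ≫
        (βs.obj F).obj.map (pullbackCoverApp g ((fetBaseChange (hMor f U)).obj W)).op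
    rw [reassoc_of% unitApp_transitionApp, invImageToBetaApp_naturality,
      reassoc_of% unitApp_invImageToBetaApp, reassoc_of% unitApp_invImageToBetaApp, ← Functor.map_comp,
      ← Functor.map_comp, ← op_comp, ← op_comp]
    congr 3
    rw [← comp_toSelf g, ← baseMapApp_comp, ← Category.assoc]
    congr 1
    refine FaltingsSite.hom_ext (Category.id_comp _) ?_
    change (bcCompApp (gY_h f g) W).left ≫ baseMapLeft f g W = bcFst _ _
    refine bc_ext ?_ ?_
    · rw [Category.assoc, baseMapLeft_fst, bcCompApp_fst]
    · rw [Category.assoc, baseMapLeft_hom, ← Category.assoc, MorphismProperty.Over.w, bcFst_w]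
  exact congrArg (fun m => m.hom.app (op V)) hm

lemma alpha_map_pullbackCoverApp {Z' Z : FaltingsSite f} (a : Z' ⟶ Z) :
    (alpha f Z'.base).map (bcLift a.coverHom a.w) ≫ pullbackCoverApp a.baseHom Z.cover = a :=
  FaltingsSite.hom_ext (Category.id_comp _)
    (bcLift_fst (f := gY f a.baseHom) (V := Z.cover) a.coverHom a.w)

/-- The canonical morphism from the presheaf `(V ⟶ U) ↦ ((h_U)^* F)(V)` to `β^* F`. -/
def invImageToBeta : invImagePresheaf adj F ⟶ (βs.obj F).obj where
  app Z := invImageToBetaApp adj adjβ F Z.unop.base Z.unop.cover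
  naturality {Z Z'} a := by
    have h : (transitionApp adj F a.unop.baseHom Z.unop.cover ≫
        ((L Z'.unop.base).obj F).obj.map (bcLift a.unop.coverHom a.unop.w).op) ≫
        invImageToBetaApp adj adjβ F Z'.unop.base Z'.unop.cover =
      invImageToBetaApp adj adjβ F Z.unop.base Z.unop.cover ≫ (βs.obj F).obj.map
        ((alpha f Z'.unop.base).map (bcLift a.unop.coverHom a.unop.w) ≫
          pullbackCoverApp a.unop.baseHom Z.unop.cover).op := by
      rw [Category.assoc, invImageToBetaApp_naturality, ← Category.assoc,
        transition_invImageToBetaApp, Category.assoc, ← Functor.map_comp, ← op_comp]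
    exact h.trans (congrArg (fun t => invImageToBetaApp adj adjβ F Z.unop.base Z.unop.cover ≫
      (βs.obj F).obj.map t.op) (alpha_map_pullbackCoverApp a.unop))

end CanonicalMorphism

/-! ### The morphism from `β^*` to `Ψ_* ρ^*` -/

instance : IsIso (hMor f (etSelf X)) :=
  inferInstanceAs (IsIso (pullback.snd (𝟙 X) f))

/-- The canonical isomorphism `V ×_Y X_Y ⟶ V`. -/
def betaPsiApp (V : FEt Y) : (psiPlus f).obj ((betaPlus f).obj V) ≅ (fetToEt Y).obj V :=
  MorphismProperty.Over.isoMk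
    (@asIso _ _ _ _ (bcFst (hMor f (etSelf X)) V)
      (bc_isPullback (hMor f (etSelf X)) V).isIso_fst_of_isIso) (bcFst_w _ _)

/-- The canonical isomorphisms `V ×_Y X_Y ⟶ V`, as an isomorphism of functors. -/
def betaPsiIso : betaPlus f ⋙ psiPlus f ≅ fetToEt Y :=
  NatIso.ofComponents (betaPsiApp f) (by
    intro V' V m
    exact MorphismProperty.Over.Hom.ext (bcMap_fst (hMor f (etSelf X)) m))

/-- The canonical isomorphism `ρ_* ≅ β_* Ψ_*`. -/
def rhoIso : rhoPush Y ≅ psiPush f ⋙ betaPush f where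
  hom :=
    { app G := ⟨Functor.whiskerRight (NatTrans.op (betaPsiIso f).hom) G.obj⟩
      naturality G' G m := by
        ext W x
        exact (ConcreteCategory.congr_hom
          (m.hom.naturality ((betaPsiIso f).hom.app W.unop).op) x).symm }
  inv :=
    { app G := ⟨Functor.whiskerRight (NatTrans.op (betaPsiIso f).inv) G.obj⟩
      naturality G' G m := by
        ext W x
        exact (ConcreteCategory.congr_hom
          (m.hom.naturality ((betaPsiIso f).inv.app W.unop).op) x).symm }
  hom_inv_id := by
    ext G W x
    change (G.obj.map ((betaPsiIso f).hom.app W.unop).op ≫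
      G.obj.map ((betaPsiIso f).inv.app W.unop).op) x = x
    rw [← Functor.map_comp, ← op_comp, Iso.inv_hom_id_app, op_id, CategoryTheory.Functor.map_id]
    rfl
  inv_hom_id := by
    ext G W x
    change (G.obj.map ((betaPsiIso f).inv.app W.unop).op ≫
      G.obj.map ((betaPsiIso f).hom.app W.unop).op) x = x
    rw [← Functor.map_comp, ← op_comp, Iso.hom_inv_id_app, op_id, CategoryTheory.Functor.map_id]
    rfl

section Mate

variable {βs : Sheaf (fetTopology Y) (Type u) ⥤ Sheaf (coevanescentTopology f) (Type u)}
  (adjβ : βs ⊣ betaPush f)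
  {ρs : Sheaf (fetTopology Y) (Type u) ⥤ Sheaf (etTopology Y) (Type u)}
  (adjρ : ρs ⊣ rhoPush Y)

variable {f}

/-- The morphism `β^* ⟶ Ψ_* ρ^*` which is adjoint to
`𝟭 ⟶ ρ_* ρ^* ≅ β_* Ψ_* ρ^*`. -/
def betaToPsiRho : βs ⟶ ρs ⋙ psiPush f where
  app F := (adjβ.homEquiv _ _).symm (adjρ.unit.app F ≫ (rhoIso f).hom.app (ρs.obj F))
  naturality F' F m := by
    rw [← Adjunction.homEquiv_naturality_left_symm, Functor.comp_map,
      ← Adjunction.homEquiv_naturality_right_symm]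
    congr 1
    rw [← Category.assoc, ← Functor.id_map m]
    erw [adjρ.unit.naturality, Category.assoc, Category.assoc, (rhoIso f).hom.naturality]
    rfl

/-- For any inverse image functor `Ψ^*`, let `Ψ^* β^* ⟶ ρ^*` be the canonical isomorphism between
two left adjoints of `ρ_* ≅ β_* Ψ_*`. The morphism `betaToPsiRho` is the morphism
`β^* ⟶ Ψ_* ρ^*` which is adjoint to it. -/
lemma betaToPsiRho_eq {Ψs : Sheaf (coevanescentTopology f) (Type u) ⥤ Sheaf (etTopology Y) (Type u)}
    (adjΨ : Ψs ⊣ psiPush f) (F : Sheaf (fetTopology Y) (Type u)) :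
    (betaToPsiRho adjβ adjρ).app F = adjΨ.homEquiv _ _
      (((conjugateIsoEquiv adjρ (adjβ.comp adjΨ)).symm (rhoIso f)).hom.app F) := by
  apply (adjβ.homEquiv _ _).injective
  change adjβ.homEquiv _ _ ((adjβ.homEquiv _ _).symm _) = _
  rw [Equiv.apply_symm_apply]
  have h := unit_conjugateEquiv_symm adjρ (adjβ.comp adjΨ) (rhoIso f).hom F
  refine h.trans ?_
  rw [Adjunction.comp_unit_app, adjβ.homEquiv_unit, adjΨ.homEquiv_unit, Category.assoc,
    Functor.map_comp]
  rfl

end Mate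

end Faltings

/-- A scheme `Y` is étale-locally connected if, for every étale morphism `Y' ⟶ Y`, the connected
components of `Y'` are open. -/
def EtaleLocallyConnected (Y : Scheme.{u}) : Prop :=
  ∀ ⦃Y' : Scheme.{u}⦄ (g : Y' ⟶ Y) [Etale g] (y : Y'), IsOpen (connectedComponent y)

end

end Faltings

open Faltings

/-!
Everything rests on one description of the inverse image of a sheaf `F` by `ρ : Y_ét ⟶ Y_fét`.
Let `P` be the étale sheaf associated with `N ↦ colim F(W)`, the colimit being over the morphisms
from `N` to finite étale `Y`-schemes `W` (`exists_etaleExtension`; the colimit is small because a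
finite étale scheme over a quasi-compact scheme is determined by an affine étale covering `T` of it
and by an open subset of `T ×_Y T`, see `exists_small_family`). All that is used of `P` is recorded in
the structure `EtaleExtension`: its sections locally come from `F`, and sections of `F` which become
equal in `P` are locally identified by `F`.

As the connected components of finite étale `Y`-schemes are open, `P` satisfies unique continuation
(`EtaleExtension.map_clopenι_eq`): sections of `F` over a connected `W` which agree in `P` near one
point of an étale scheme over `W` are equal. The reason is that a finite étale morphism to a connected
scheme is surjective as soon as its source is nonempty. Hence the locus in `N ×_Y W` where a given
section of `P` over `N` coincides with a given element of `F(W)` is open and closed, so that it is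
finite étale over `N`. In this way, "étale locally" can be replaced by "finite étale locally" in the
description of `P` (`EtaleExtension.exists_finEtMor_eq_sec`,
`EtaleExtension.exists_finEtMor_of_sec_eq`).

Now let `Θ` be a functor from a site to the étale site of `Y`, which is partially left adjoint to a
functor `Φ` on the finite étale `Y`-schemes, and such that finite étale coverings of `Θ(D)` lift to
coverings of `D`. By the finite étale description of `P`, a morphism from `Θ_* P` to a sheaf `G` is the
same as a morphism from `F` to `Φ_* G` (`FetLifting.bijective_unit_comp`). This applies to the étale
site of `Y` (so `P` is `ρ^* F`), to the Faltings site, where finite étale coverings are vertical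
coverings (so `Ψ_* P` is `β^* F`), to the finite étale site of `U_Y` (so `V ↦ P(V)` is `(h_U)^* F`), and
to the finite étale site of `Y` (so `F` is `ρ_* P`). The inverse image functors thus exist, and the
three assertions say that the canonical morphisms between these descriptions are the obvious
isomorphisms. The sheaf property on the objects of finite presentation follows from the fact that
these objects are stable under fibre products.
-/

namespace Faltings

/-! ### Smallness of the category of finite étale schemes -/

section Smallness

/-- Let `T ⟶ V` be an effective epimorphism and `T ⟶ V'` a morphism of schemes over `Y`, where `V'`
is étale over `Y`. If `T ×_V T` and `T ×_{V'} T` have the same image in `T ×_Y T`, where the second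
one is open, then `T ⟶ V'` factors through `V`. -/
lemma exists_comp_eq_of_range_eq {T V V' Y : Scheme.{u}} {h : T ⟶ Y} {p : T ⟶ V} {q : V ⟶ Y}
    {p' : T ⟶ V'} {q' : V' ⟶ Y} [EffectiveEpi p] [Etale q'] (e : p ≫ q = h) (e' : p' ≫ q' = h)
    (H : Set.range (pullback.lift (f := h) (g := h) (pullback.fst p p) (pullback.snd p p)
        (by rw [← e, pullback.condition_assoc])) =
      Set.range (pullback.lift (f := h) (g := h) (pullback.fst p' p') (pullback.snd p' p')
        (by rw [← e', pullback.condition_assoc]))) :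
    ∃ a : V ⟶ V', p ≫ a = p' := by
  refine ⟨EffectiveEpi.desc p p' fun {Z} g₁ g₂ hg => ?_, EffectiveEpi.fac _ _ _⟩
  subst e'
  let j := pullback.lift (f := p' ≫ q') (g := p' ≫ q') (pullback.fst p' p') (pullback.snd p' p')
    (by rw [pullback.condition_assoc])
  let i := pullback.lift (f := p' ≫ q') (g := p' ≫ q') (pullback.fst p p) (pullback.snd p p)
    (by rw [← e, pullback.condition_assoc])
  -- The morphism `j` is a base change of the diagonal of `V'` over `Y`.
  have hj : IsOpenImmersion j := by
    have : IsOpenImmersion (pullback.mapDesc p' p' q') :=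
      MorphismProperty.of_isPullback (pullback_map_diagonal_isPullback p' p' q') inferInstance
    convert this using 1
    apply pullback.hom_ext
    · exact (pullback.lift_fst _ _ _).trans
        ((pullback.lift_fst _ _ _).trans (Category.comp_id _)).symm
    · exact (pullback.lift_snd _ _ _).trans
        ((pullback.lift_snd _ _ _).trans (Category.comp_id _)).symm
  let k := pullback.lift g₁ g₂ hg ≫ i
  have hk : Set.range k ⊆ Set.range j := by
    rw [← H]
    rintro _ ⟨z, rfl⟩
    exact ⟨pullback.lift g₁ g₂ hg z, by simp [k, i]⟩
  have h₁ : IsOpenImmersion.lift j k hk ≫ pullback.fst p' p' = g₁ := by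
    have h : j ≫ pullback.fst _ _ = pullback.fst p' p' := pullback.lift_fst _ _ _
    have h' : i ≫ pullback.fst _ _ = pullback.fst p p := pullback.lift_fst _ _ _
    rw [← h, IsOpenImmersion.lift_fac_assoc, Category.assoc, h', pullback.lift_fst]
  have h₂ : IsOpenImmersion.lift j k hk ≫ pullback.snd p' p' = g₂ := by
    have h : j ≫ pullback.snd _ _ = pullback.snd p' p' := pullback.lift_snd _ _ _
    have h' : i ≫ pullback.snd _ _ = pullback.snd p p := pullback.lift_snd _ _ _
    rw [← h, IsOpenImmersion.lift_fac_assoc, Category.assoc, h', pullback.lift_snd]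
  rw [← h₁, ← h₂, Category.assoc, Category.assoc, pullback.condition]

/-- A scheme `V` over `Y` is presented by a morphism `h : T ⟶ Y` and a subset `R` of `T ×_Y T` if
there is an étale surjective `Y`-morphism `T ⟶ V` such that `R` is the image of `T ×_V T`. -/
def IsPresentedBy {Y : Scheme.{u}} (V : FEt Y) {T : Scheme.{u}} (h : T ⟶ Y)
    (R : Set ↑(pullback h h)) : Prop :=
  ∃ (p : T ⟶ V.left) (e : p ≫ V.hom = h), Etale p ∧ Surjective p ∧
    R = Set.range (pullback.lift (f := h) (g := h) (pullback.fst p p) (pullback.snd p p)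
        (by rw [← e, pullback.condition_assoc]))

/-- A presentation determines a finite étale scheme up to isomorphism, because étale surjective
morphisms are effective epimorphisms. -/
lemma IsPresentedBy.nonempty_iso {Y : Scheme.{u}} {V V' : FEt Y} {T : Scheme.{u}} {h : T ⟶ Y}
    {R : Set ↑(pullback h h)} (H : IsPresentedBy V h R) (H' : IsPresentedBy V' h R) :
    Nonempty (V ≅ V') := by
  obtain ⟨p, e, _, _, hR⟩ := H
  obtain ⟨p', e', _, _, hR'⟩ := H'
  have : Etale V.hom := V.prop.2
  have : Etale V'.hom := V'.prop.2
  obtain ⟨a, ha⟩ := exists_comp_eq_of_range_eq e e' (hR.symm.trans hR')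
  obtain ⟨b, hb⟩ := exists_comp_eq_of_range_eq e' e (hR'.symm.trans hR)
  refine ⟨MorphismProperty.Over.isoMk ⟨a, b, ?_, ?_⟩ ?_⟩
  · rw [← cancel_epi p, reassoc_of% ha, hb, Category.comp_id]
  · rw [← cancel_epi p', reassoc_of% hb, ha, Category.comp_id]
  · rw [← cancel_epi p]
    change p ≫ a ≫ V'.hom = p ≫ V.hom
    rw [reassoc_of% ha, e, e']

/-- A finite étale scheme `V` over a quasi-compact scheme is quasi-compact, hence it is presented by a
finite disjoint union of affine open subschemes of `V`. -/
lemma exists_isPresentedBy {Y : Scheme.{u}} [CompactSpace Y] (V : FEt Y) :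
    ∃ (A : SmallModel.{u} (Scheme.AffineEtale Y))
      (R : Set ↑(pullback ((equivSmallModel (Scheme.AffineEtale Y)).inverse.obj A).hom
        ((equivSmallModel (Scheme.AffineEtale Y)).inverse.obj A).hom)),
      IsPresentedBy V ((equivSmallModel (Scheme.AffineEtale Y)).inverse.obj A).hom R := by
  let v : V.left ⟶ Y := V.hom
  have : IsFinite v := V.prop.1
  have : Etale v := V.prop.2
  have : CompactSpace V.left := QuasiCompact.compactSpace_of_compactSpace v
  let 𝒰 := V.left.affineCover.finiteSubcover
  let p : ∐ 𝒰.X ⟶ V.left := Sigma.desc 𝒰.f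
  have : IsZariskiLocalAtSource @Etale.{u} := HasRingHomProperty.instIsZariskiLocalAtSource
  have hp : Etale p := IsZariskiLocalAtSource.sigmaDesc (P := @Etale.{u}) fun i =>
    inferInstanceAs (Etale (𝒰.f i))
  have hs : Surjective p := inferInstance
  have : IsAffine (∐ 𝒰.X) := inferInstance
  let B : Scheme.AffineEtale Y := Scheme.AffineEtale.mk ((∐ 𝒰.X).isoSpec.inv ≫ p ≫ v)
  let i := (Scheme.AffineEtale.Spec Y).mapIso
    ((equivSmallModel (Scheme.AffineEtale Y)).unitIso.symm.app B)
  let i' : Spec (unop ((equivSmallModel Y.AffineEtale).inverse.obj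
      ((equivSmallModel Y.AffineEtale).functor.obj B)).left) ≅ Spec Γ(∐ 𝒰.X, ⊤) :=
    (MorphismProperty.Over.forget _ ⊤ Y ⋙ Over.forget Y).mapIso i
  have hi : i'.hom ≫ (∐ 𝒰.X).isoSpec.inv ≫ p ≫ v = _ := MorphismProperty.Over.w i.hom
  refine ⟨(equivSmallModel (Scheme.AffineEtale Y)).functor.obj B, _,
    i'.hom ≫ (∐ 𝒰.X).isoSpec.inv ≫ p, ?_, ?_, ?_, rfl⟩
  · exact ((Category.assoc _ _ _).trans (i'.hom ≫= Category.assoc _ _ _)).trans hi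
  · infer_instance
  · infer_instance

/-- The finite étale schemes over a quasi-compact scheme form a small set, up to isomorphism. -/
lemma exists_small_family (Y : Scheme.{u}) [CompactSpace Y] :
    ∃ (I : Type u) (W : I → FEt Y), ∀ V : FEt Y, ∃ i, Nonempty (V ≅ W i) := by
  let h (A : SmallModel.{u} (Scheme.AffineEtale Y)) :=
    ((equivSmallModel (Scheme.AffineEtale Y)).inverse.obj A).hom
  let I := { d : Σ A, Set ↑(pullback (h A) (h A)) // ∃ V : FEt Y, IsPresentedBy V (h d.1) d.2 }
  refine ⟨I, fun i => i.2.choose, fun V => ?_⟩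
  obtain ⟨A, R, H⟩ := exists_isPresentedBy V
  let i : I := ⟨⟨A, R⟩, V, H⟩
  exact ⟨i, H.nonempty_iso i.2.choose_spec⟩

end Smallness

/-! ### Points, fibre products and open-closed subschemes -/

section Geometry

lemma presheaf_comp {C : Type*} [Category* C] (P : Cᵒᵖ ⥤ Type w) {A B D : C} (f : A ⟶ B)
    (g : B ⟶ D) (x : P.obj (op D)) : P.map (f ≫ g).op x = P.map f.op (P.map g.op x) := by
  rw [op_comp, Functor.map_comp]
  rfl

section

variable {P : MorphismProperty Scheme.{u}} [P.IsStableUnderBaseChange] [P.IsMultiplicative]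
    [P.HasOfPostcompProperty P] {X : Scheme.{u}} {A B Z : P.Over ⊤ X}

/-- The morphism to the fibre product given by its two components. -/
noncomputable def fiberProd.homLift {S : P.Over ⊤ X} {f : A ⟶ Z} {g : B ⟶ Z} (a : S ⟶ A) (b : S ⟶ B)
    (e : a ≫ f = b ≫ g) : S ⟶ fiberProd f g :=
  MorphismProperty.Over.homMk
    (fiberProd.lift f g a.left b.left (congrArg (fun m : S ⟶ Z => m.left) e))
    ((fiberProd.lift_hom _ _ _ _ _).trans (MorphismProperty.Over.w a))

lemma fiberProd.homLift_fst {S : P.Over ⊤ X} {f : A ⟶ Z} {g : B ⟶ Z} (a : S ⟶ A) (b : S ⟶ B)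
    (e : a ≫ f = b ≫ g) : fiberProd.homLift a b e ≫ fiberProd.fst f g = a :=
  MorphismProperty.Over.Hom.ext (fiberProd.lift_fst f g _ _ _)

lemma fiberProd.homLift_snd {S : P.Over ⊤ X} {f : A ⟶ Z} {g : B ⟶ Z} (a : S ⟶ A) (b : S ⟶ B)
    (e : a ≫ f = b ≫ g) : fiberProd.homLift a b e ≫ fiberProd.snd f g = b :=
  MorphismProperty.Over.Hom.ext (fiberProd.lift_snd f g _ _ _)

lemma fiberProd.exists_point {f : A ⟶ Z} {g : B ⟶ Z} (a : A.left) (b : B.left)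
    (e : f.left a = g.left b) :
    ∃ z : (fiberProd f g).left, (fiberProd.fst f g).left z = a ∧ (fiberProd.snd f g).left z = b :=
  Scheme.Pullback.exists_preimage_pullback a b e

end

variable {X : Scheme.{u}}

lemma left_mem_of_hom {P : MorphismProperty Scheme.{u}} [P.HasOfPostcompProperty P]
    {A B : P.Over ⊤ X} (f : A ⟶ B) : P f.left :=
  P.of_postcomp f.left B.hom B.prop (by rw [MorphismProperty.Over.w]; exact A.prop)

lemma fetOpens_mem {V : Scheme.{u}} (U : V.Opens) (hU : IsClosed (U : Set V)) :
    finEtMor U.ι := by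
  have : IsClosedImmersion U.ι :=
    { isClosedEmbedding := ⟨U.ι.isOpenEmbedding.isEmbedding, by simpa using hU⟩ }
  exact ⟨inferInstance, inferInstance⟩

/-- An open and closed subscheme of a finite étale scheme, as a finite étale scheme. -/
def clopenPart (V : FEt X) (U : V.left.Opens) (hU : IsClosed (U : Set V.left)) : FEt X :=
  MorphismProperty.Over.mk ⊤ (U.ι ≫ V.hom) (finEtMor.comp_mem _ _ (fetOpens_mem U hU) V.prop)

/-- The inclusion of an open and closed subscheme. -/
def clopenι (V : FEt X) (U : V.left.Opens) (hU : IsClosed (U : Set V.left)) :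
    clopenPart V U hU ⟶ V :=
  MorphismProperty.Over.homMk U.ι rfl

/-- An open subscheme of an étale scheme, as an étale scheme. -/
def openPart (V : Et X) (U : V.left.Opens) : Et X :=
  MorphismProperty.Over.mk ⊤ (U.ι ≫ V.hom)
    (etMor.comp_mem _ _ (inferInstanceAs (Etale U.ι)) V.prop)

/-- The inclusion of an open subscheme. -/
def openι (V : Et X) (U : V.left.Opens) : openPart V U ⟶ V :=
  MorphismProperty.Over.homMk U.ι rfl

lemma isOpenMap_left {A B : Et X} (f : A ⟶ B) : IsOpenMap f.left := by
  have : Etale f.left := left_mem_of_hom (P := etMor) f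
  exact f.left.isOpenMap

/-- A finite étale morphism from a nonempty scheme to a preconnected one is surjective. -/
lemma surjective_of_finEtMor {A B : Scheme.{u}} {f : A ⟶ B} (hf : finEtMor f) [Nonempty A]
    [PreconnectedSpace B] : Function.Surjective f := by
  obtain ⟨_, _⟩ := hf
  rw [← Set.range_eq_univ]
  exact IsClopen.eq_univ ⟨f.isClosedMap.isClosed_range, f.isOpenMap.isOpen_range⟩
    (Set.range_nonempty f)

lemma et_ext (P : Sheaf (etTopology X) (Type u)) {N : Et X} {s s' : P.obj.obj (op N)}
    (h : ∀ v : N.left, ∃ (N' : Et X) (g : N' ⟶ N) (v' : N'.left), g.left v' = v ∧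
      P.obj.map g.op s = P.obj.map g.op s') : s = s' := by
  let S : Sieve N :=
    { arrows := fun N' g => P.obj.map g.op s = P.obj.map g.op s'
      downward_closed := fun {N' N''} g hg k => by
        rw [op_comp, Functor.map_comp]
        exact congrArg (P.obj.map k.op) hg }
  have hS : S ∈ etTopology X N := (mem_etTopology S).2 fun v => by
    obtain ⟨N', g, v', hv, e⟩ := h v
    exact ⟨N', g, v', e, hv⟩
  exact (((isSheaf_iff_isSheaf_of_type _ _).1 P.2).isSeparated S hS).ext fun _ _ hf => hf

lemma fet_injective_of_surjective (F : Sheaf (fetTopology X) (Type u)) {A B : FEt X} (m : A ⟶ B)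
    (hm : Function.Surjective m.left) : Function.Injective (F.obj.map m.op) := by
  intro s s' e
  have hS : Sieve.generate (Presieve.singleton m) ∈ fetTopology X B :=
    (mem_fetTopology _).2 fun v => by
      obtain ⟨a, ha⟩ := hm v
      exact ⟨A, m, a, Sieve.le_generate _ _ _ ⟨⟩, ha⟩
  refine (((isSheaf_iff_isSheaf_of_type _ _).1 F.2).isSeparated _ hS).ext ?_
  rintro _ _ ⟨_, k, _, ⟨⟩, rfl⟩
  rw [op_comp, Functor.map_comp]
  exact congrArg (F.obj.map k.op) e

/-- If étale `X`-schemes have open connected components, then every point of a finite étale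
`X`-scheme has a preconnected open and closed neighbourhood. -/
lemma EtaleLocallyConnected.exists_clopen (hX : EtaleLocallyConnected X) {V : FEt X} (v : V.left) :
    ∃ U : V.left.Opens, IsClosed (U : Set V.left) ∧ _root_.IsPreconnected (U : Set V.left) ∧ v ∈ U :=
  ⟨⟨connectedComponent v, @hX _ V.hom V.prop.2 v⟩, isClosed_connectedComponent,
    isPreconnected_connectedComponent, mem_connectedComponent⟩

lemma exists_lift_equalizer {A B : FEt X} (c c' : A ⟶ B) {N : Et X}
    (r : N ⟶ (fetToEt X).obj A) (e : r ≫ (fetToEt X).map c = r ≫ (fetToEt X).map c') :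
    ∃ r' : N ⟶ (fetToEt X).obj (equalizer c c'), r' ≫ (fetToEt X).map (equalizer.ι c c') = r :=
  ⟨_, Fork.IsLimit.lift_ι' (isLimitOfHasEqualizerOfPreservesLimit (fetToEt X) c c') r e⟩

lemma exists_lift_prod {A B : FEt X} {N : Et X} (a : N ⟶ (fetToEt X).obj A)
    (b : N ⟶ (fetToEt X).obj B) :
    ∃ q : N ⟶ (fetToEt X).obj (A ⨯ B), q ≫ (fetToEt X).map prod.fst = a ∧
      q ≫ (fetToEt X).map prod.snd = b :=
  ⟨_, (isLimitOfHasBinaryProductOfPreservesLimit (fetToEt X) A B).fac (BinaryFan.mk a b)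
      ⟨WalkingPair.left⟩,
    (isLimitOfHasBinaryProductOfPreservesLimit (fetToEt X) A B).fac (BinaryFan.mk a b)
      ⟨WalkingPair.right⟩⟩

end Geometry

/-! ### Extensions of a sheaf to the étale site -/

/-- Data exhibiting a sheaf `P` on the étale site of `Y` as the inverse image of a sheaf `F` on the
finite étale site: the sections of `P` are locally given by sections of `F`, and two sections of `F`
define the same section of `P` if and only if they are locally identified by `F`. -/
structure EtaleExtension {Y : Scheme.{u}} (F : Sheaf (fetTopology Y) (Type u))
    (P : Sheaf (etTopology Y) (Type u)) where
  /-- The section of `P` over `N` given by a morphism from `N` to a finite étale `Y`-scheme `W` and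
  by a section of `F` over `W`. -/
  sec {N : Et Y} {W : FEt Y} (t : N ⟶ (fetToEt Y).obj W) (x : F.obj.obj (op W)) : P.obj.obj (op N)
  map_sec {N' N : Et Y} {W : FEt Y} (g : N' ⟶ N) (t : N ⟶ (fetToEt Y).obj W)
    (x : F.obj.obj (op W)) : P.obj.map g.op (sec t x) = sec (g ≫ t) x
  sec_comp {N : Et Y} {W W' : FEt Y} (t : N ⟶ (fetToEt Y).obj W) (c : W ⟶ W')
    (x : F.obj.obj (op W')) : sec (t ≫ (fetToEt Y).map c) x = sec t (F.obj.map c.op x)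
  exists_eq_sec {N : Et Y} (s : P.obj.obj (op N)) (v : N.left) :
    ∃ (N' : Et Y) (g : N' ⟶ N) (v' : N'.left) (W : FEt Y) (t : N' ⟶ (fetToEt Y).obj W)
      (x : F.obj.obj (op W)), g.left v' = v ∧ P.obj.map g.op s = sec t x
  exists_of_sec_eq {N : Et Y} {W W' : FEt Y} {t : N ⟶ (fetToEt Y).obj W}
    {t' : N ⟶ (fetToEt Y).obj W'} {x : F.obj.obj (op W)} {x' : F.obj.obj (op W')}
    (e : sec t x = sec t' x') (v : N.left) :
    ∃ (N' : Et Y) (g : N' ⟶ N) (v' : N'.left) (W'' : FEt Y) (c : W'' ⟶ W) (c' : W'' ⟶ W')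
      (r : N' ⟶ (fetToEt Y).obj W''), g.left v' = v ∧ r ≫ (fetToEt Y).map c = g ≫ t ∧
      r ≫ (fetToEt Y).map c' = g ≫ t' ∧ F.obj.map c.op x = F.obj.map c'.op x'

namespace EtaleExtension

variable {Y : Scheme.{u}} {F : Sheaf (fetTopology Y) (Type u)} {P : Sheaf (etTopology Y) (Type u)}
  (E : EtaleExtension F P)

/-- Unique continuation: two sections of `F` over a finite étale `Y`-scheme which coincide, as
sections of `P`, near a point of an étale scheme over it, coincide on any preconnected open and
closed neighbourhood of the image of this point. -/
lemma map_clopenι_eq {N : Et Y} {W : FEt Y} {t : N ⟶ (fetToEt Y).obj W} {x y : F.obj.obj (op W)}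
    (e : E.sec t x = E.sec t y) (v : N.left) {U : W.left.Opens} (hU : IsClosed (U : Set W.left))
    (hc : _root_.IsPreconnected (U : Set W.left)) (hv : t.left v ∈ U) :
    F.obj.map (clopenι W U hU).op x = F.obj.map (clopenι W U hU).op y := by
  obtain ⟨N', g, v', W'', c, c', r, rfl, h, h', e'⟩ := E.exists_of_sec_eq e v
  -- After passing to the equalizer of `c` and `c'`, there is a single morphism `a` to `W` by which
  -- `x` and `y` have the same inverse image.
  obtain ⟨r', rfl⟩ := exists_lift_equalizer c c' r (h.trans h'.symm)
  let a := equalizer.ι c c' ≫ c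
  have ha : F.obj.map a.op x = F.obj.map a.op y := by
    have ha' : a = equalizer.ι c c' ≫ c' := equalizer.condition c c'
    conv_rhs => rw [ha']
    simp only [a, op_comp, Functor.map_comp]
    exact congrArg (F.obj.map (equalizer.ι c c').op) e'
  have hr : a.left (r'.left v') = t.left (g.left v') :=
    congrArg (fun m : N' ⟶ (fetToEt Y).obj W => m.left v') h
  obtain ⟨b, -, -⟩ := fiberProd.exists_point (f := a) (g := clopenι W U hU) (r'.left v')
    ⟨t.left (g.left v'), hv⟩ hr
  have hs : Function.Surjective (fiberProd.snd a (clopenι W U hU)).left := by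
    have : Nonempty (fiberProd a (clopenι W U hU)).left := ⟨b⟩
    have : PreconnectedSpace (clopenPart W U hU).left := isPreconnected_iff_preconnectedSpace.1 hc
    exact surjective_of_finEtMor (left_mem_of_hom (P := finEtMor) _)
  apply fet_injective_of_surjective F _ hs
  have key (z : F.obj.obj (op W)) :
      F.obj.map (fiberProd.snd a (clopenι W U hU)).op (F.obj.map (clopenι W U hU).op z) =
        F.obj.map (fiberProd.fst a (clopenι W U hU)).op (F.obj.map a.op z) := by
    rw [← presheaf_comp, ← presheaf_comp, fiberProd.condition]
  rw [key, key, ha]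

/-- Two sections of `F` which define the same section of `P` are identified by `F` after passing to
a finite étale scheme. -/
lemma exists_finEtMor_of_sec_eq (hY : EtaleLocallyConnected Y) {N : Et Y} {W W' : FEt Y}
    {t : N ⟶ (fetToEt Y).obj W} {t' : N ⟶ (fetToEt Y).obj W'} {x : F.obj.obj (op W)}
    {x' : F.obj.obj (op W')} (e : E.sec t x = E.sec t' x') (v : N.left) :
    ∃ (N' : Et Y) (g : N' ⟶ N) (v' : N'.left) (W'' : FEt Y) (c : W'' ⟶ W) (c' : W'' ⟶ W')
      (r : N' ⟶ (fetToEt Y).obj W''), finEtMor g.left ∧ g.left v' = v ∧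
      r ≫ (fetToEt Y).map c = g ≫ t ∧ r ≫ (fetToEt Y).map c' = g ≫ t' ∧
      F.obj.map c.op x = F.obj.map c'.op x' := by
  obtain ⟨q, rfl, rfl⟩ := exists_lift_prod t t'
  obtain ⟨U, hU, hc, hv⟩ := hY.exists_clopen (V := W ⨯ W') (q.left v)
  rw [E.sec_comp, E.sec_comp] at e
  have h := E.map_clopenι_eq e v hU hc hv
  let j := (fetToEt Y).map (clopenι _ U hU)
  obtain ⟨z, hz, -⟩ := fiberProd.exists_point (f := q) (g := j) v ⟨q.left v, hv⟩ rfl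
  refine ⟨fiberProd q j, fiberProd.fst q j, z, _, clopenι _ U hU ≫ prod.fst,
    clopenι _ U hU ≫ prod.snd, fiberProd.snd q j, ?_, hz, ?_, ?_, ?_⟩
  · exact finEtMor.pullback_fst _ _ (fetOpens_mem U hU)
  · rw [Functor.map_comp, ← Category.assoc, ← Category.assoc, ← fiberProd.condition]
  · rw [Functor.map_comp, ← Category.assoc, ← Category.assoc, ← fiberProd.condition]
  · rw [presheaf_comp, presheaf_comp, h]

/-- The locus where a section `s` of `P` over `Q` coincides with the section given by `x ∈ F(W)` and
a morphism `b : Q ⟶ W`. -/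
def coincidence {Q : Et Y} (s : P.obj.obj (op Q)) {W : FEt Y} (b : Q ⟶ (fetToEt Y).obj W)
    (x : F.obj.obj (op W)) : Set Q.left :=
  { z | ∃ (M : Et Y) (m : M ⟶ Q) (μ : M.left), m.left μ = z ∧
    P.obj.map m.op s = E.sec (m ≫ b) x }

/-- The coincidence locus is locally constant: near a point, `s` comes from a section `y` of `F`, and
whether `y` and `x` coincide on a connected component of the product of the finite étale schemes over
which they are defined decides whether `s` and `x` coincide at the points above this component. -/
lemma exists_isOpen_coincidence (hY : EtaleLocallyConnected Y) {Q : Et Y} (s : P.obj.obj (op Q))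
    {W : FEt Y} (b : Q ⟶ (fetToEt Y).obj W) (x : F.obj.obj (op W)) (z : Q.left) :
    ∃ O : Set Q.left, IsOpen O ∧ z ∈ O ∧
      (O ⊆ E.coincidence s b x ∨ O ⊆ (E.coincidence s b x)ᶜ) := by
  obtain ⟨M, m, μ, W', a, y, rfl, hm⟩ := E.exists_eq_sec s z
  obtain ⟨q, hq₁, hq₂⟩ := exists_lift_prod a (m ≫ b)
  obtain ⟨U, hU, hc, hμ⟩ := hY.exists_clopen (V := W' ⨯ W) (q.left μ)
  have hq (M' : Et Y) (m' : M' ⟶ M) : P.obj.map (m' ≫ m).op s =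
      E.sec (m' ≫ q) (F.obj.map (prod.fst (X := W') (Y := W)).op y) := by
    rw [presheaf_comp, hm, E.map_sec, ← hq₁, ← Category.assoc, E.sec_comp]
  have hq' (M' : Et Y) (m' : M' ⟶ M) : E.sec (m' ≫ m ≫ b) x =
      E.sec (m' ≫ q) (F.obj.map (prod.snd (X := W') (Y := W)).op x) := by
    rw [← hq₂, ← Category.assoc, E.sec_comp]
  refine ⟨m.left '' (q.left ⁻¹' (U : Set (W' ⨯ W).left)), isOpenMap_left m _
    (U.isOpen.preimage q.left.continuous), ⟨μ, hμ, rfl⟩, ?_⟩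
  by_cases h : F.obj.map (clopenι _ U hU).op (F.obj.map (prod.fst (X := W') (Y := W)).op y) =
    F.obj.map (clopenι _ U hU).op (F.obj.map (prod.snd (X := W') (Y := W)).op x)
  · left
    rintro _ ⟨μ', hμ', rfl⟩
    let j := (fetToEt Y).map (clopenι _ U hU)
    obtain ⟨z, hz, -⟩ := fiberProd.exists_point (f := q) (g := j) μ' ⟨q.left μ', hμ'⟩ rfl
    refine ⟨fiberProd q j, fiberProd.fst q j ≫ m, z, congrArg m.left hz, ?_⟩
    rw [Category.assoc, hq, hq', fiberProd.condition, E.sec_comp, E.sec_comp, h]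
  · right
    rintro _ ⟨μ', hμ', rfl⟩ ⟨M₂, m₂, μ₂, e, h₂⟩
    obtain ⟨z, hz, -⟩ := fiberProd.exists_point (f := m) (g := m₂) μ' μ₂ e.symm
    have e₃ : E.sec (fiberProd.fst m m₂ ≫ q) (F.obj.map (prod.fst (X := W') (Y := W)).op y) =
        E.sec (fiberProd.fst m m₂ ≫ q) (F.obj.map (prod.snd (X := W') (Y := W)).op x) := by
      rw [← hq, ← hq', ← Category.assoc, fiberProd.condition, Category.assoc,
        presheaf_comp, h₂, E.map_sec]
    refine h (E.map_clopenι_eq e₃ z hU hc ?_)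
    change q.left ((fiberProd.fst m m₂).left z) ∈ U
    rw [hz]
    exact hμ'

/-- The coincidence locus of two sections is open by definition, and closed by unique
continuation. -/
lemma isClopen_coincidence (hY : EtaleLocallyConnected Y) {Q : Et Y} (s : P.obj.obj (op Q))
    {W : FEt Y} (b : Q ⟶ (fetToEt Y).obj W) (x : F.obj.obj (op W)) :
    IsClopen (E.coincidence s b x) := by
  constructor
  · refine isOpen_compl_iff.1 (isOpen_iff_forall_mem_open.2 fun z hz => ?_)
    obtain ⟨O, hO, hz', h | h⟩ := E.exists_isOpen_coincidence hY s b x z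
    · exact (hz (h hz')).elim
    · exact ⟨O, h, hO, hz'⟩
  · refine isOpen_iff_forall_mem_open.2 fun z hz => ?_
    obtain ⟨O, hO, hz', h | h⟩ := E.exists_isOpen_coincidence hY s b x z
    · exact ⟨O, h, hO, hz'⟩
    · exact (h hz' hz).elim

lemma map_openι_eq_sec {Q : Et Y} (s : P.obj.obj (op Q)) {W : FEt Y}
    (b : Q ⟶ (fetToEt Y).obj W) (x : F.obj.obj (op W)) (U : Q.left.Opens)
    (hU : (U : Set Q.left) ⊆ E.coincidence s b x) :
    P.obj.map (openι Q U).op s = E.sec (openι Q U ≫ b) x := by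
  refine et_ext P fun z => ?_
  obtain ⟨M, m, μ, hμ, e⟩ := hU z.2
  obtain ⟨z', hz', -⟩ := fiberProd.exists_point (f := openι Q U) (g := m) z μ hμ.symm
  refine ⟨_, fiberProd.fst (openι Q U) m, z', hz', ?_⟩
  rw [← presheaf_comp, E.map_sec, ← Category.assoc, fiberProd.condition,
    Category.assoc, presheaf_comp, e, E.map_sec]

/-- Every section of `P` comes, after passing to a finite étale scheme, from a section of `F`: if
the section is given by `x ∈ F(W)` near a point of `N`, the locus in `N ×_Y W` where it coincides
with `x` is open and closed, hence finite étale over `N`. -/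
lemma exists_finEtMor_eq_sec (hY : EtaleLocallyConnected Y) {N : Et Y} (s : P.obj.obj (op N))
    (v : N.left) :
    ∃ (N' : Et Y) (g : N' ⟶ N) (v' : N'.left) (W : FEt Y) (t : N' ⟶ (fetToEt Y).obj W)
      (x : F.obj.obj (op W)), finEtMor g.left ∧ g.left v' = v ∧ P.obj.map g.op s = E.sec t x := by
  obtain ⟨N', g, v', W, t, x, rfl, hs⟩ := E.exists_eq_sec s v
  let Q : Et Y := fiberProd (toSelf N) (toSelf ((fetToEt Y).obj W))
  let p₁ : Q ⟶ N := fiberProd.fst _ _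
  let p₂ : Q ⟶ (fetToEt Y).obj W := fiberProd.snd _ _
  have hp₁ : finEtMor p₁.left :=
    finEtMor.pullback_fst (toSelf N).left (toSelf ((fetToEt Y).obj W)).left W.prop
  let q₀ : N' ⟶ Q := fiberProd.homLift g t (by rw [comp_toSelf, comp_toSelf])
  have hq₁ : q₀ ≫ p₁ = g := fiberProd.homLift_fst g t _
  have hq₂ : q₀ ≫ p₂ = t := fiberProd.homLift_snd g t _
  clear_value p₁ p₂ q₀ Q
  have hc := E.isClopen_coincidence hY (P.obj.map p₁.op s) p₂ x
  let U : Q.left.Opens := ⟨_, hc.isOpen⟩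
  have h₀ : q₀.left v' ∈ U :=
    ⟨N', q₀, v', rfl, by rw [← presheaf_comp, hq₁, hq₂, hs]⟩
  refine ⟨openPart Q U, openι Q U ≫ p₁, ⟨q₀.left v', h₀⟩, W, openι Q U ≫ p₂, x, ?_, ?_, ?_⟩
  · exact finEtMor.comp_mem _ _ (fetOpens_mem U hc.isClosed) hp₁
  · exact congrArg (fun m : N' ⟶ N => m.left v') hq₁
  · rw [presheaf_comp]
    exact E.map_openι_eq_sec _ _ _ U subset_rfl

end EtaleExtension

/-! ### The inverse image on the étale site -/

section Extension

variable {Y : Scheme.{u}}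

instance : HasSheafify (etTopology Y) (Type u) :=
  inferInstanceAs (HasSheafify Y.smallEtaleTopology (Type u))

instance : (etTopology Y).WEqualsLocallyBijective (Type u) :=
  inferInstanceAs (Y.smallEtaleTopology.WEqualsLocallyBijective (Type u))

/-- Two sections `x ∈ F(W)` and `x' ∈ F(W')`, with morphisms from an étale scheme `N` to `W` and `W'`,
are identified if they coincide over a finite étale scheme through which both morphisms factor. -/
def SecRel (F : Sheaf (fetTopology Y) (Type u)) {N : Et Y} {W W' : FEt Y}
    (t : N ⟶ (fetToEt Y).obj W) (x : F.obj.obj (op W)) (t' : N ⟶ (fetToEt Y).obj W')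
    (x' : F.obj.obj (op W')) : Prop :=
  ∃ (W'' : FEt Y) (c : W'' ⟶ W) (c' : W'' ⟶ W') (r : N ⟶ (fetToEt Y).obj W''),
    r ≫ (fetToEt Y).map c = t ∧ r ≫ (fetToEt Y).map c' = t' ∧
      F.obj.map c.op x = F.obj.map c'.op x'

section

variable {F : Sheaf (fetTopology Y) (Type u)} {N : Et Y} {W W' W'' : FEt Y}
  {t : N ⟶ (fetToEt Y).obj W} {x : F.obj.obj (op W)} {t' : N ⟶ (fetToEt Y).obj W'}
  {x' : F.obj.obj (op W')} {t'' : N ⟶ (fetToEt Y).obj W''} {x'' : F.obj.obj (op W'')}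

lemma SecRel.symm (h : SecRel F t x t' x') : SecRel F t' x' t x := by
  obtain ⟨V, c, c', r, h, h', e⟩ := h
  exact ⟨V, c', c, r, h', h, e.symm⟩

lemma SecRel.trans (h₁ : SecRel F t x t' x') (h₂ : SecRel F t' x' t'' x'') :
    SecRel F t x t'' x'' := by
  obtain ⟨V₁, c, c', r₁, rfl, h, e₁⟩ := h₁
  obtain ⟨V₂, d, d', r₂, h', rfl, e₂⟩ := h₂
  obtain ⟨r, rfl, rfl⟩ : ∃ r : N ⟶ (fetToEt Y).obj (pullback c' d),
      r ≫ (fetToEt Y).map (pullback.fst c' d) = r₁ ∧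
      r ≫ (fetToEt Y).map (pullback.snd c' d) = r₂ :=
    ⟨_, PullbackCone.IsLimit.lift_fst (isLimitOfHasPullbackOfPreservesLimit (fetToEt Y) c' d)
        r₁ r₂ (h.trans h'.symm),
      PullbackCone.IsLimit.lift_snd (isLimitOfHasPullbackOfPreservesLimit (fetToEt Y) c' d) _ _ _⟩
  refine ⟨pullback c' d, pullback.fst c' d ≫ c, pullback.snd c' d ≫ d', r, ?_, ?_, ?_⟩
  · rw [Functor.map_comp, Category.assoc]
  · rw [Functor.map_comp, Category.assoc]
  · rw [presheaf_comp, presheaf_comp, e₁, ← e₂, ← presheaf_comp, ← presheaf_comp,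
      pullback.condition]

lemma SecRel.comp_left {N' : Et Y} (g : N' ⟶ N) (h : SecRel F t x t' x') :
    SecRel F (g ≫ t) x (g ≫ t') x' := by
  obtain ⟨V, c, c', r, rfl, rfl, e⟩ := h
  exact ⟨V, c, c', g ≫ r, Category.assoc _ _ _, Category.assoc _ _ _, e⟩

end

lemma SecRel.comp {F : Sheaf (fetTopology Y) (Type u)} {N : Et Y} {W W' : FEt Y}
    (t : N ⟶ (fetToEt Y).obj W) (c : W ⟶ W') (x : F.obj.obj (op W')) :
    SecRel F (t ≫ (fetToEt Y).map c) x t (F.obj.map c.op x) :=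
  ⟨W, c, 𝟙 W, t, rfl, by simp, by simp⟩

lemma SecRel.refl {F : Sheaf (fetTopology Y) (Type u)} {N : Et Y} {W : FEt Y}
    (t : N ⟶ (fetToEt Y).obj W) (x : F.obj.obj (op W)) : SecRel F t x t x :=
  ⟨W, 𝟙 W, 𝟙 W, t, by simp, by simp, rfl⟩

variable {I : Type u} (R : I → FEt Y) (F : Sheaf (fetTopology Y) (Type u))

/-- The identification of the sections given by the finite étale schemes of a family `R`. -/
def secSetoid (N : Et Y) : Setoid (Σ i, (N ⟶ (fetToEt Y).obj (R i)) × F.obj.obj (op (R i))) where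
  r a b := SecRel F a.2.1 a.2.2 b.2.1 b.2.2
  iseqv := ⟨fun _ => SecRel.refl _ _, SecRel.symm, SecRel.trans⟩

/-- The presheaf on the étale site whose sections over `N` are the sections of `F` over the finite
étale schemes (in a family `R` of representatives) to which `N` maps: it is the colimit of
the sets `F(W)` over the morphisms from `N` to finite étale `Y`-schemes `W`. -/
def preExtension : (Et Y)ᵒᵖ ⥤ Type u where
  obj N := Quotient (secSetoid R F N.unop)
  map {N N'} g := ↾(Quotient.map (fun a => ⟨a.1, g.unop ≫ a.2.1, a.2.2⟩)
    fun _ _ h => SecRel.comp_left g.unop h)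
  map_id N := by
    ext a
    obtain ⟨i, t, x⟩ := a
    exact congrArg (fun t => Quotient.mk (secSetoid R F N.unop) ⟨i, t, x⟩) (Category.id_comp t)
  map_comp {N N' N''} g g' := by
    ext a
    obtain ⟨i, t, x⟩ := a
    exact congrArg (fun t => Quotient.mk (secSetoid R F N''.unop) ⟨i, t, x⟩)
      (Category.assoc g'.unop g.unop t)

variable {R} (hR : ∀ V : FEt Y, ∃ i, Nonempty (V ≅ R i))

/-- The section of the presheaf `preExtension R F` given by a section of `F`. -/
noncomputable def preSec {N : Et Y} {W : FEt Y} (t : N ⟶ (fetToEt Y).obj W)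
    (x : F.obj.obj (op W)) : (preExtension R F).obj (op N) :=
  Quotient.mk (secSetoid R F N) ⟨(hR W).choose, t ≫ (fetToEt Y).map (hR W).choose_spec.some.hom,
    F.obj.map (hR W).choose_spec.some.inv.op x⟩

lemma secRel_representative {N : Et Y} {W : FEt Y} (t : N ⟶ (fetToEt Y).obj W)
    (x : F.obj.obj (op W)) :
    SecRel F (t ≫ (fetToEt Y).map (hR W).choose_spec.some.hom)
      (F.obj.map (hR W).choose_spec.some.inv.op x) t x := by
  have h := SecRel.comp (F := F) t (hR W).choose_spec.some.hom
    (F.obj.map (hR W).choose_spec.some.inv.op x)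
  rwa [← presheaf_comp, Iso.hom_inv_id, op_id, CategoryTheory.Functor.map_id] at h

lemma preSec_eq_iff {N : Et Y} {W W' : FEt Y} (t : N ⟶ (fetToEt Y).obj W)
    (x : F.obj.obj (op W)) (t' : N ⟶ (fetToEt Y).obj W') (x' : F.obj.obj (op W')) :
    preSec F hR t x = preSec F hR t' x' ↔ SecRel F t x t' x' := by
  refine (Quotient.eq (r := secSetoid R F N)).trans ⟨fun h => ?_, fun h => ?_⟩
  · exact ((secRel_representative F hR t x).symm.trans h).trans (secRel_representative F hR t' x')
  · exact ((secRel_representative F hR t x).trans h).trans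
      (secRel_representative F hR t' x').symm

lemma map_preSec {N' N : Et Y} {W : FEt Y} (g : N' ⟶ N) (t : N ⟶ (fetToEt Y).obj W)
    (x : F.obj.obj (op W)) :
    (preExtension R F).map g.op (preSec F hR t x) = preSec F hR (g ≫ t) x :=
  congrArg (fun t => Quotient.mk (secSetoid R F N') ⟨(hR W).choose, t,
    F.obj.map (hR W).choose_spec.some.inv.op x⟩) (Category.assoc _ _ _).symm

lemma exists_eq_preSec {N : Et Y} (s : (preExtension R F).obj (op N)) :
    ∃ (W : FEt Y) (t : N ⟶ (fetToEt Y).obj W) (x : F.obj.obj (op W)), s = preSec F hR t x := by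
  obtain ⟨⟨i, t, x⟩, rfl⟩ := Quotient.exists_rep s
  exact ⟨R i, t, x, Quotient.sound (s := secSetoid R F N) (secRel_representative F hR t x).symm⟩

/-- Every sheaf on the finite étale site of a quasi-compact scheme has an extension to the étale
site. -/
lemma exists_etaleExtension [CompactSpace Y] (F : Sheaf (fetTopology Y) (Type u)) :
    ∃ P : Sheaf (etTopology Y) (Type u), Nonempty (EtaleExtension F P) := by
  obtain ⟨I, R, hR⟩ := exists_small_family Y
  let θ := toSheafify (etTopology Y) (preExtension R F)
  have nat {N' N : Et Y} (g : N' ⟶ N) (a : (preExtension R F).obj (op N)) :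
      (sheafify (etTopology Y) (preExtension R F)).map g.op (θ.app (op N) a) =
        θ.app (op N') ((preExtension R F).map g.op a) :=
    (ConcreteCategory.congr_hom (θ.naturality g.op) a).symm
  refine ⟨(presheafToSheaf (etTopology Y) (Type u)).obj (preExtension R F), ⟨
    { sec := fun {N} _ t x => θ.app (op N) (preSec F hR t x)
      map_sec := fun g t x => (nat g _).trans (congrArg _ (map_preSec F hR g t x))
      sec_comp := fun {N} _ _ t c x =>
        congrArg (θ.app (op N)) ((preSec_eq_iff F hR _ _ _ _).2 (SecRel.comp t c x))
      exists_eq_sec := fun {N} s v => ?_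
      exists_of_sec_eq := fun {N W W' t t' x x'} e v => ?_ }⟩⟩
  · obtain ⟨N', g, v', ⟨a, ha⟩, hv⟩ :=
      (mem_etTopology _).1 (Presheaf.imageSieve_mem (etTopology Y) θ (U := op N) s) v
    obtain ⟨W, t, x, rfl⟩ := exists_eq_preSec F hR a
    exact ⟨N', g, v', W, t, x, hv, ha.symm⟩
  · obtain ⟨N', g, v', h, hv⟩ := (mem_etTopology _).1
      (Presheaf.equalizerSieve_mem (etTopology Y) θ (X := op N) _ _ e) v
    have h' : (preExtension R F).map g.op (preSec F hR t x) =
      (preExtension R F).map g.op (preSec F hR t' x') := h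
    rw [map_preSec, map_preSec, preSec_eq_iff] at h'
    obtain ⟨W'', c, c', r, h₁, h₂, h₃⟩ := h'
    exact ⟨N', g, v', W'', c, c', r, hv, h₁, h₂, h₃⟩

end Extension

/-! ### Reflections along a functor -/

section Reflection

variable {A B : Type*} [Category* A] [Category* B]

/-- A morphism `η : F ⟶ R(P)` is universal among the morphisms from `F` to objects of the form
`R(G)`. -/
def IsReflection (R : A ⥤ B) {F : B} {P : A} (η : F ⟶ R.obj P) : Prop :=
  ∀ G : A, Function.Bijective fun k : P ⟶ G => η ≫ R.map k

lemma isRightAdjoint_of_isReflection (R : A ⥤ B)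
    (h : ∀ F : B, ∃ (P : A) (η : F ⟶ R.obj P), IsReflection R η) : R.IsRightAdjoint := by
  choose P η h using h
  exact ⟨_, ⟨Adjunction.adjunctionOfEquivLeft (F_obj := P)
    (fun F G => Equiv.ofBijective _ (h F G)) fun F G G' g k => by simp⟩⟩

/-- A universal morphism `F ⟶ R(P)` identifies `P` with the value at `F` of any left adjoint. -/
lemma IsReflection.isIso {R : A ⥤ B} {L : B ⥤ A} (adj : L ⊣ R) {F : B} {P : A} {η : F ⟶ R.obj P}
    (h : IsReflection R η) : IsIso ((adj.homEquiv F P).symm η) := by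
  obtain ⟨k, hk : η ≫ R.map k = adj.unit.app F⟩ := (h (L.obj F)).2 (adj.unit.app F)
  refine ⟨k, ?_, (h P).1 ?_⟩
  · apply (adj.homEquiv _ _).injective
    rw [Adjunction.homEquiv_naturality_right, Equiv.apply_symm_apply, hk, adj.homEquiv_unit,
      CategoryTheory.Functor.map_id]
    exact (Category.comp_id _).symm
  · change η ≫ R.map (k ≫ _) = η ≫ R.map (𝟙 _)
    rw [R.map_comp, reassoc_of% hk, ← adj.homEquiv_unit, Equiv.apply_symm_apply,
      CategoryTheory.Functor.map_id, Category.comp_id]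

lemma unit_comp_map_homEquiv_symm {R : A ⥤ B} {L : B ⥤ A} (adj : L ⊣ R) {F : B} {P : A}
    (η : F ⟶ R.obj P) : adj.unit.app F ≫ R.map ((adj.homEquiv F P).symm η) = η :=
  (adj.homEquiv_unit F P _).symm.trans ((adj.homEquiv F P).apply_symm_apply η)

lemma IsReflection.isIso_of_id {F P : A} {η : F ⟶ P} (h : IsReflection (𝟭 A) η) : IsIso η := by
  have := h.isIso Adjunction.id
  have e : (Adjunction.id.homEquiv F P).symm η = η := Category.comp_id _
  rwa [e] at this

end Reflection

/-! ### Universal property of the extension -/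

section Universal

variable {Y : Scheme.{u}}

/-- Given a functor `Θ` from a site to the étale site of `Y`, data exhibiting `Θ` as a partial left
adjoint to a functor `Φ` defined on the finite étale `Y`-schemes, such that the families of finite
étale morphisms to `Θ(D)` which are jointly surjective lift to coverings of `D`. -/
structure FetLifting {D : Type*} [Category* D] (J : GrothendieckTopology D) (Θ : D ⥤ Et Y)
    (Φ : FEt Y ⥤ D) where
  /-- The counit of the partial adjunction. -/
  counit : Φ ⋙ Θ ⟶ fetToEt Y
  existsUnique {Z : D} {W : FEt Y} (t : Θ.obj Z ⟶ (fetToEt Y).obj W) :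
    ∃! a : Z ⟶ Φ.obj W, Θ.map a ≫ counit.app W = t
  mem {Z : D} (S : Sieve (Θ.obj Z)) (hS : ∀ v : (Θ.obj Z).left, ∃ (N : Et Y) (g : N ⟶ Θ.obj Z)
    (v' : N.left), finEtMor g.left ∧ S g ∧ g.left v' = v) : S.functorPullback Θ ∈ J Z

namespace FetLifting

variable {D : Type*} [Category* D] {J : GrothendieckTopology D} {Θ : D ⥤ Et Y} {Φ : FEt Y ⥤ D}
  (H : FetLifting J Θ Φ) {F : Sheaf (fetTopology Y) (Type u)} {P : Sheaf (etTopology Y) (Type u)}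
  (E : EtaleExtension F P)

/-- The morphism `F ⟶ Φ_* Θ_* P`. -/
def unit : F.obj ⟶ Φ.op ⋙ Θ.op ⋙ P.obj where
  app W := ↾fun x => E.sec (H.counit.app W.unop) x
  naturality W W' c := by
    ext x
    change E.sec (H.counit.app W'.unop) (F.obj.map c.unop.op x) =
      P.obj.map (Θ.map (Φ.map c.unop)).op (E.sec (H.counit.app W.unop) x)
    rw [← E.sec_comp, E.map_sec]
    exact congrArg (fun t => E.sec t x) (H.counit.naturality c.unop).symm

variable {G : Sheaf J (Type u)} (φ : F.obj ⟶ Φ.op ⋙ G.obj)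

/-- The pairs of a section of `Θ_* P` and a section of `G` which are given by a same section of
`F`. -/
def Related {Z : D} (s : P.obj.obj (op (Θ.obj Z))) (g : G.obj.obj (op Z)) : Prop :=
  ∃ (W : FEt Y) (a : Z ⟶ Φ.obj W) (x : F.obj.obj (op W)),
    s = E.sec (Θ.map a ≫ H.counit.app W) x ∧ g = G.obj.map a.op (φ.app (op W) x)

variable {H E φ}

lemma Related.map {Z Z' : D} {s : P.obj.obj (op (Θ.obj Z))} {g : G.obj.obj (op Z)}
    (h : H.Related E φ s g) (k : Z' ⟶ Z) :
    H.Related E φ (P.obj.map (Θ.map k).op s) (G.obj.map k.op g) := by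
  obtain ⟨W, a, x, rfl, rfl⟩ := h
  refine ⟨W, k ≫ a, x, ?_, (presheaf_comp _ _ _ _).symm⟩
  rw [E.map_sec, Functor.map_comp, Category.assoc]

/-- Two sections of `G` related to the same section of `Θ_* P` are given by sections of `F` which
define the same section of `P`; as these are identified by `F` after a finite étale covering, the
sections of `G` are locally equal. -/
lemma Related.unique (hY : EtaleLocallyConnected Y) {Z : D} {s : P.obj.obj (op (Θ.obj Z))}
    {g g' : G.obj.obj (op Z)} (h : H.Related E φ s g) (h' : H.Related E φ s g') : g = g' := by
  obtain ⟨W, a, x, rfl, rfl⟩ := h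
  obtain ⟨W', a', x', e, rfl⟩ := h'
  let S : Sieve (Θ.obj Z) :=
    { arrows := fun N f => SecRel F (f ≫ Θ.map a ≫ H.counit.app W) x
        (f ≫ Θ.map a' ≫ H.counit.app W') x'
      downward_closed := fun h k => by
        rw [Category.assoc, Category.assoc]
        exact h.comp_left k }
  have hS : S.functorPullback Θ ∈ J Z := H.mem S fun v => by
    obtain ⟨N, f, v', W'', c, c', r, hf, hv, h₁, h₂, h₃⟩ := E.exists_finEtMor_of_sec_eq hY e v
    exact ⟨N, f, v', hf, ⟨W'', c, c', r, h₁, h₂, h₃⟩, hv⟩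
  refine (((isSheaf_iff_isSheaf_of_type _ _).1 G.2).isSeparated _ hS).ext fun Z' f hf => ?_
  obtain ⟨W'', c, c', r, h₁, h₂, h₃⟩ := hf
  obtain ⟨b, hb, -⟩ := H.existsUnique r
  have key {V : FEt Y} (c : W'' ⟶ V) (a : Z ⟶ Φ.obj V)
      (h : r ≫ (fetToEt Y).map c = Θ.map f ≫ Θ.map a ≫ H.counit.app V) :
      b ≫ Φ.map c = f ≫ a := by
    refine (H.existsUnique (Θ.map f ≫ Θ.map a ≫ H.counit.app V)).unique ?_ ?_
    · rw [← h, ← hb, Functor.map_comp, Category.assoc, Category.assoc]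
      exact congrArg _ (H.counit.naturality c)
    · rw [Functor.map_comp, Category.assoc]
  have nat {V : FEt Y} (c : W'' ⟶ V) (x : F.obj.obj (op V)) :
      G.obj.map (Φ.map c).op (φ.app (op V) x) = φ.app (op W'') (F.obj.map c.op x) :=
    (ConcreteCategory.congr_hom (φ.naturality c.op) x).symm
  rw [← presheaf_comp, ← presheaf_comp, ← key c a h₁, ← key c' a' h₂, presheaf_comp,
    presheaf_comp, nat, nat, h₃]

variable (H E φ)

/-- The sections of `Θ_* P` come from `F` locally for the topology of the site. -/
lemma exists_related_mem (hY : EtaleLocallyConnected Y) {Z : D} (s : P.obj.obj (op (Θ.obj Z))) :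
    ∃ S ∈ J Z, ∀ ⦃Z' : D⦄ (f : Z' ⟶ Z), S f →
      ∃ (W : FEt Y) (a : Z' ⟶ Φ.obj W) (x : F.obj.obj (op W)),
        P.obj.map (Θ.map f).op s = E.sec (Θ.map a ≫ H.counit.app W) x := by
  let S : Sieve (Θ.obj Z) :=
    { arrows := fun N f => ∃ (W : FEt Y) (t : N ⟶ (fetToEt Y).obj W) (x : F.obj.obj (op W)),
        P.obj.map f.op s = E.sec t x
      downward_closed := by
        rintro N N' f ⟨W, t, x, e⟩ k
        exact ⟨W, k ≫ t, x, by rw [presheaf_comp, e, E.map_sec]⟩ }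
  refine ⟨S.functorPullback Θ, H.mem S fun v => ?_, ?_⟩
  · obtain ⟨N, f, v', W, t, x, hf, hv, e⟩ := E.exists_finEtMor_eq_sec hY s v
    exact ⟨N, f, v', hf, ⟨W, t, x, e⟩, hv⟩
  · rintro Z' f ⟨W, t, x, e⟩
    obtain ⟨a, rfl, -⟩ := H.existsUnique t
    exact ⟨W, a, x, e⟩

/-- The section of `G` determined by a section of `Θ_* P` exists by gluing. -/
lemma exists_forall_related (hY : EtaleLocallyConnected Y) {Z : D}
    (s : P.obj.obj (op (Θ.obj Z))) :
    ∃ g : G.obj.obj (op Z), ∀ ⦃Z' : D⦄ (f : Z' ⟶ Z) (g' : G.obj.obj (op Z')),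
      H.Related E φ (P.obj.map (Θ.map f).op s) g' → G.obj.map f.op g = g' := by
  obtain ⟨S, hS, h⟩ := H.exists_related_mem E hY s
  have h' ⦃Z' : D⦄ (f : Z' ⟶ Z) (hf : S f) :
      ∃ g, H.Related E φ (P.obj.map (Θ.map f).op s) g := by
    obtain ⟨W, a, x, e⟩ := h f hf
    exact ⟨_, W, a, x, e, rfl⟩
  choose y hy using h'
  have hG := (isSheaf_iff_isSheaf_of_type _ _).1 G.2
  let y' : Presieve.FamilyOfElements G.obj S.arrows := fun Z' f hf => y f hf
  obtain ⟨g, hg, -⟩ := hG S hS y' ((Presieve.compatible_iff_sieveCompatible y').2 (by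
    intro Z' Z'' f k hf
    refine (hy (k ≫ f) _).unique hY ?_
    have := (hy f hf).map k
    rwa [← presheaf_comp, ← Functor.map_comp] at this))
  refine ⟨g, fun Z' f g' hg' => ?_⟩
  refine (hG.isSeparated _ (J.pullback_stable f hS)).ext fun Z'' k hk => ?_
  rw [← presheaf_comp, hg (k ≫ f) hk]
  refine (hy (k ≫ f) hk).unique hY ?_
  have := hg'.map k
  rwa [← presheaf_comp, ← Functor.map_comp] at this

/-- The sheaf `Θ_* P` is universal for morphisms from `F` to direct images by `Φ`. -/
theorem bijective_unit_comp (hY : EtaleLocallyConnected Y) (G : Sheaf J (Type u)) :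
    Function.Bijective fun k : Θ.op ⋙ P.obj ⟶ G.obj =>
      H.unit E ≫ Functor.whiskerLeft Φ.op k := by
  have hG := (isSheaf_iff_isSheaf_of_type _ _).1 G.2
  constructor
  · intro k k' e
    ext Z s
    obtain ⟨S, hS, h⟩ := H.exists_related_mem E hY (Z := Z.unop) s
    refine (hG.isSeparated _ hS).ext fun Z' f hf => ?_
    obtain ⟨W, a, x, e'⟩ := h f hf
    have key (k : Θ.op ⋙ P.obj ⟶ G.obj) : G.obj.map f.op (k.app Z s) =
        G.obj.map a.op ((H.unit E ≫ Functor.whiskerLeft Φ.op k).app (op W) x) := by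
      refine (ConcreteCategory.congr_hom (k.naturality f.op) s).symm.trans ?_
      refine Eq.trans ?_ (ConcreteCategory.congr_hom (k.naturality a.op)
        (E.sec (H.counit.app W) x))
      refine congrArg (k.app (op Z')) (e'.trans ?_)
      exact (E.map_sec _ _ _).symm
    exact (key k).trans ((congrArg (fun m : F.obj ⟶ Φ.op ⋙ G.obj =>
      G.obj.map a.op (m.app (op W) x)) e).trans (key k').symm)
  · intro φ
    choose χ hχ using fun (Z : D) (s : P.obj.obj (op (Θ.obj Z))) =>
      H.exists_forall_related E φ hY s
    refine ⟨{ app := fun Z => ↾(χ Z.unop), naturality := fun Z Z' f => ?_ }, ?_⟩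
    · ext s
      change χ Z'.unop (P.obj.map (Θ.map f.unop).op s) = G.obj.map f.unop.op (χ Z.unop s)
      obtain ⟨S, hS, h⟩ := H.exists_related_mem E hY (P.obj.map (Θ.map f.unop).op s)
      refine (hG.isSeparated _ hS).ext fun Z'' k hk => ?_
      obtain ⟨W, a, x, e⟩ := h k hk
      have hr : H.Related E φ (P.obj.map (Θ.map k).op (P.obj.map (Θ.map f.unop).op s)) _ :=
        ⟨W, a, x, e, rfl⟩
      rw [hχ _ _ k _ hr, ← presheaf_comp]
      rw [← presheaf_comp, ← Functor.map_comp] at hr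
      exact (hχ _ _ (k ≫ f.unop) _ hr).symm
    · ext W x
      have hr : H.Related E φ (P.obj.map (Θ.map (𝟙 (Φ.obj W.unop))).op
          (E.sec (H.counit.app W.unop) x)) (φ.app W x) := by
        refine ⟨W.unop, 𝟙 _, x, ?_, ?_⟩
        · rw [E.map_sec]
        · simp
      have := hχ _ _ (𝟙 _) _ hr
      rw [op_id, CategoryTheory.Functor.map_id] at this
      exact this

/-- The universal property of `bijective_unit_comp`, for the direct image functor. -/
lemma isReflection [Φ.IsContinuous (fetTopology Y) J] (hY : EtaleLocallyConnected Y)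
    (hB : Presheaf.IsSheaf J (Θ.op ⋙ P.obj)) :
    IsReflection (Φ.sheafPushforwardContinuous (Type u) (fetTopology Y) J) (F := F)
      (P := ⟨Θ.op ⋙ P.obj, hB⟩) ⟨H.unit E⟩ := by
  intro G
  obtain ⟨h₁, h₂⟩ := H.bijective_unit_comp E hY G
  constructor
  · intro k k' e
    exact Sheaf.hom_ext (h₁ (congrArg (fun m => m.hom) e))
  · intro φ
    obtain ⟨k, hk⟩ := h₂ φ.hom
    exact ⟨⟨k⟩, Sheaf.hom_ext hk⟩

end FetLifting

end Universal

/-! ### The sites to which the universal property applies -/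

noncomputable section Sites

/-- A finite étale morphism to a finite étale scheme, as a morphism of finite étale schemes. -/
def fetOver {A : Scheme.{u}} (V : FEt A) {T : Scheme.{u}} (g : T ⟶ V.left) (hg : finEtMor g) :
    FEt A :=
  MorphismProperty.Over.mk ⊤ (g ≫ V.hom) (finEtMor.comp_mem _ _ hg V.prop)

/-- The morphism from `fetOver V g hg` to `V`. -/
def fetOverHom {A : Scheme.{u}} (V : FEt A) {T : Scheme.{u}} (g : T ⟶ V.left) (hg : finEtMor g) :
    fetOver V g hg ⟶ V :=
  MorphismProperty.Over.homMk g rfl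

lemma mem_fetTopology_of_finEtMor {A : Scheme.{u}} {V : FEt A} (S : Sieve V)
    (hS : ∀ v : V.left, ∃ (T : Scheme.{u}) (g : T ⟶ V.left) (hg : finEtMor g) (t : T),
      S (fetOverHom V g hg) ∧ g t = v) : S ∈ fetTopology A V :=
  (mem_fetTopology S).2 fun v => by
    obtain ⟨T, g, hg, t, h, e⟩ := hS v
    exact ⟨fetOver V g hg, fetOverHom V g hg, t, h, e⟩

/-- The universal property for the étale site itself. -/
def etLifting (Y : Scheme.{u}) : FetLifting (etTopology Y) (𝟭 (Et Y)) (fetToEt Y) where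
  counit := 𝟙 _
  existsUnique t := ⟨t, Category.comp_id _, fun _ h => (Category.comp_id _).symm.trans h⟩
  mem S hS := (mem_etTopology _).2 fun v => by
    obtain ⟨N, g, v', -, h, e⟩ := hS v
    exact ⟨N, g, v', h, e⟩

/-- The universal property for the finite étale site itself. -/
def fetLifting (Y : Scheme.{u}) : FetLifting (fetTopology Y) (fetToEt Y) (𝟭 (FEt Y)) where
  counit := 𝟙 _
  existsUnique {Z W} t := ⟨MorphismProperty.Over.homMk t.left (MorphismProperty.Over.w t),
    MorphismProperty.Over.Hom.ext (Category.comp_id _), fun a h =>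
      MorphismProperty.Over.Hom.ext ((Category.comp_id _).symm.trans
        (congrArg (fun m : (fetToEt Y).obj Z ⟶ (fetToEt Y).obj W => m.left) h))⟩
  mem {Z} S hS := mem_fetTopology_of_finEtMor _ fun v => by
    obtain ⟨N, g, v', hg, h, e⟩ := hS v
    refine ⟨N.left, g.left, hg, v', ?_, e⟩
    let k : (fetToEt Y).obj (fetOver Z g.left hg) ⟶ N :=
      MorphismProperty.Over.homMk (𝟙 _) ((Category.id_comp _).trans
        (MorphismProperty.Over.w g).symm)
    have hk : k ≫ g = (fetToEt Y).map (fetOverHom Z g.left hg) :=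
      MorphismProperty.Over.Hom.ext (Category.id_comp _)
    change S ((fetToEt Y).map (fetOverHom Z g.left hg))
    rw [← hk]
    exact S.downward_closed h k

variable {X Y : Scheme.{u}} (f : Y ⟶ X)

lemma alpha_psiPlus_map_fetOverHom_mem {U : Et X} {V : FEt (UY f U)}
    (S : Sieve ((alpha f U ⋙ psiPlus f).obj V)) {N : Et Y}
    {g : N ⟶ (alpha f U ⋙ psiPlus f).obj V} (hg : finEtMor g.left) (h : S g) :
    S ((alpha f U ⋙ psiPlus f).map (fetOverHom V g.left hg)) := by
  let k : (alpha f U ⋙ psiPlus f).obj (fetOver V g.left hg) ⟶ N :=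
    MorphismProperty.Over.homMk (𝟙 _) ((Category.id_comp _).trans
      ((MorphismProperty.Over.w g).symm.trans (Category.assoc _ _ _).symm))
  have hk : k ≫ g = (alpha f U ⋙ psiPlus f).map (fetOverHom V g.left hg) :=
    MorphismProperty.Over.Hom.ext (Category.id_comp _)
  rw [← hk]
  exact S.downward_closed h k

/-- The universal property for the finite étale site of `U_Y`. -/
def uyLifting (U : Et X) :
    FetLifting (fetTopology (UY f U)) (alpha f U ⋙ psiPlus f) (fetBaseChange (hMor f U)) where
  counit :=
    { app W := MorphismProperty.Over.homMk (bcFst (hMor f U) W) (bcFst_w (hMor f U) W)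
      naturality _ _ m := MorphismProperty.Over.Hom.ext (bcMap_fst (hMor f U) m) }
  existsUnique {Z W} t := ⟨bcLift (V := W) (f := hMor f U) t.left (MorphismProperty.Over.w t),
    MorphismProperty.Over.Hom.ext (bcLift_fst (V := W) (f := hMor f U) t.left _),
    fun a h => bc_hom_ext (((congrArg (fun m : (alpha f U ⋙ psiPlus f).obj Z ⟶
      (fetToEt Y).obj W => m.left) h)).trans
        (bcLift_fst (V := W) (f := hMor f U) t.left (MorphismProperty.Over.w t)).symm)⟩
  mem {Z} S hS := mem_fetTopology_of_finEtMor _ fun v => by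
    obtain ⟨N, g, v', hg, h, e⟩ := hS v
    exact ⟨N.left, g.left, hg, v', alpha_psiPlus_map_fetOverHom_mem f S hg h, e⟩

/-- Finite étale coverings of `V` define vertical coverings of `(V ⟶ U)`. -/
lemma psiPlus_functorPullback_mem {Z : FaltingsSite f} (S : Sieve ((psiPlus f).obj Z))
    (hS : ∀ v : ((psiPlus f).obj Z).left, ∃ (N : Et Y) (g : N ⟶ (psiPlus f).obj Z) (v' : N.left),
      finEtMor g.left ∧ S g ∧ g.left v' = v) :
    S.functorPullback (psiPlus f) ∈ coevanescentTopology f Z := by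
  obtain ⟨U, V⟩ := Z
  let T : Sieve V := (S.functorPullback (psiPlus f)).functorPullback (alpha f U)
  have hT : Sieve.generate T.arrows ∈ fetTopology (UY f U) V := by
    rw [Sieve.generate_sieve]
    exact (uyLifting f U).mem S hS
  have h := Precoverage.generate_mem_toGrothendieck (J := coevanescentPrecoverage f)
    (Or.inl (VerticalCovering.mk U V T.arrows hT))
  refine (coevanescentTopology f).superset_covering ((Sieve.generate_le_iff _ _).2 ?_) h
  rintro _ _ ⟨hb⟩
  exact hb

/-- The universal property for the Faltings site. -/
def faltingsLifting : FetLifting (coevanescentTopology f) (psiPlus f) (betaPlus f) where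
  counit := (betaPsiIso f).hom
  existsUnique {Z W} t := by
    have hw : t.left ≫ W.hom = (Z.cover.hom ≫ gY f (toSelf Z.base)) ≫ hMor f (etSelf X) := by
      rw [Category.assoc, gY_h]
      exact MorphismProperty.Over.w t
    let a : Z ⟶ (betaPlus f).obj W :=
      ⟨toSelf Z.base, bcPair (V := W) t.left (Z.cover.hom ≫ gY f (toSelf Z.base)) hw,
        bcPair_hom (V := W) _ _ hw⟩
    refine ⟨a, MorphismProperty.Over.Hom.ext (bcPair_fst (V := W) _ _ hw), fun b hb => ?_⟩
    -- The structural morphism is the only one from an étale `X`-scheme to `X`.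
    have hbase : b.baseHom = toSelf Z.base := by
      apply MorphismProperty.Over.Hom.ext
      have := MorphismProperty.Over.w b.baseHom
      exact (Category.comp_id _).symm.trans this
    refine FaltingsSite.hom_ext hbase (bc_ext (V := W) ?_ ?_)
    · exact (congrArg (fun m : (psiPlus f).obj Z ⟶ (fetToEt Y).obj W => m.left) hb).trans
        (bcPair_fst (V := W) _ _ hw).symm
    · refine b.w.trans ?_
      rw [hbase]
      exact (bcPair_hom (V := W) _ _ hw).symm
  mem S hS := psiPlus_functorPullback_mem f S hS

end Sites

/-! ### Sheaves on the subcategory of objects of finite presentation -/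

section Coh

variable {X Y : Scheme.{u}} (f : Y ⟶ X)

lemma isCoh_fiberProd {U U₁ U₂ : Et X} (g₁ : U₁ ⟶ U) (g₂ : U₂ ⟶ U)
    (hU : QuasiSeparated U.hom) (h₁ : QuasiCompact U₁.hom ∧ QuasiSeparated U₁.hom)
    (h₂ : QuasiCompact U₂.hom ∧ QuasiSeparated U₂.hom) :
    LocallyOfFinitePresentation (fiberProd g₁ g₂).hom ∧ QuasiCompact (fiberProd g₁ g₂).hom ∧
      QuasiSeparated (fiberProd g₁ g₂).hom := by
  obtain ⟨_, _⟩ := h₁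
  obtain ⟨_, _⟩ := h₂
  have e : g₂.left ≫ U.hom = U₂.hom := MorphismProperty.Over.w g₂
  have : QuasiCompact g₂.left := by
    have : QuasiCompact (g₂.left ≫ U.hom) := by rwa [e]
    exact QuasiCompact.of_comp g₂.left U.hom
  have : QuasiSeparated g₂.left := by
    have : QuasiSeparated (g₂.left ≫ U.hom) := by rwa [e]
    exact QuasiSeparated.of_comp g₂.left U.hom
  have : Etale (fiberProd g₁ g₂).hom := (fiberProd g₁ g₂).prop
  refine ⟨inferInstance, ?_, ?_⟩
  · change QuasiCompact (pullback.fst g₁.left g₂.left ≫ U₁.hom)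
    infer_instance
  · change QuasiSeparated (pullback.fst g₁.left g₂.left ≫ U₁.hom)
    infer_instance

/-- The objects of finite presentation have fibre products in the Faltings site, which are of finite
presentation: `W` is the fibre product of the base changes of the covers to the fibre product of the
bases. -/
lemma exists_lift_coh {Z Z₁ Z₂ : FaltingsSite f} (hZ : isCoh f Z) (hZ₁ : isCoh f Z₁)
    (hZ₂ : isCoh f Z₂) (g₁ : Z₁ ⟶ Z) (g₂ : Z₂ ⟶ Z) {T : FaltingsSite f}
    (t₁ : T ⟶ Z₁) (t₂ : T ⟶ Z₂) (ht : t₁ ≫ g₁ = t₂ ≫ g₂) :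
    ∃ (W : FaltingsSite f) (p₁ : W ⟶ Z₁) (p₂ : W ⟶ Z₂) (k : T ⟶ W), isCoh f W ∧
      p₁ ≫ g₁ = p₂ ≫ g₂ ∧ k ≫ p₁ = t₁ ∧ k ≫ p₂ = t₂ := by
  let U := fiberProd g₁.baseHom g₂.baseHom
  let q₁ : U ⟶ Z₁.base := fiberProd.fst g₁.baseHom g₂.baseHom
  let q₂ : U ⟶ Z₂.base := fiberProd.snd g₁.baseHom g₂.baseHom
  have hq : q₁ ≫ g₁.baseHom = q₂ ≫ g₂.baseHom := fiberProd.condition g₁.baseHom g₂.baseHom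
  let V₀ := (fetBaseChange (gY f (q₁ ≫ g₁.baseHom))).obj Z.cover
  let V₁ := (fetBaseChange (gY f q₁)).obj Z₁.cover
  let V₂ := (fetBaseChange (gY f q₂)).obj Z₂.cover
  let b₁ : V₁ ⟶ V₀ := bcLift (bcFst (gY f q₁) Z₁.cover ≫ g₁.coverHom) (by
    rw [Category.assoc, g₁.w, ← Category.assoc, bcFst_w, gY_comp, Category.assoc])
  let b₂ : V₂ ⟶ V₀ := bcLift (bcFst (gY f q₂) Z₂.cover ≫ g₂.coverHom) (by
    rw [Category.assoc, g₂.w, ← Category.assoc, bcFst_w, hq, gY_comp, Category.assoc])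
  have hb₁ : b₁.left ≫ bcFst _ Z.cover = bcFst (gY f q₁) Z₁.cover ≫ g₁.coverHom := bcLift_fst _ _
  have hb₂ : b₂.left ≫ bcFst _ Z.cover = bcFst (gY f q₂) Z₂.cover ≫ g₂.coverHom := bcLift_fst _ _
  let W : FaltingsSite f := ⟨U, fiberProd b₁ b₂⟩
  let p₁ : W ⟶ Z₁ := ⟨q₁, (fiberProd.fst b₁ b₂).left ≫ bcFst (gY f q₁) Z₁.cover, by
    rw [Category.assoc, bcFst_w]
    exact MorphismProperty.Over.w_assoc (fiberProd.fst b₁ b₂) _⟩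
  let p₂ : W ⟶ Z₂ := ⟨q₂, (fiberProd.snd b₁ b₂).left ≫ bcFst (gY f q₂) Z₂.cover, by
    rw [Category.assoc, bcFst_w]
    exact MorphismProperty.Over.w_assoc (fiberProd.snd b₁ b₂) _⟩
  have hp : p₁ ≫ g₁ = p₂ ≫ g₂ := by
    refine FaltingsSite.hom_ext hq ?_
    change ((fiberProd.fst b₁ b₂).left ≫ bcFst (gY f q₁) Z₁.cover) ≫ g₁.coverHom =
      ((fiberProd.snd b₁ b₂).left ≫ bcFst (gY f q₂) Z₂.cover) ≫ g₂.coverHom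
    rw [Category.assoc, Category.assoc, ← hb₁, ← hb₂, ← Category.assoc, ← Category.assoc]
    exact congrArg (fun a : fiberProd b₁ b₂ ⟶ V₀ => a.left ≫ bcFst _ Z.cover)
      (fiberProd.condition b₁ b₂)
  have htb : t₁.baseHom ≫ g₁.baseHom = t₂.baseHom ≫ g₂.baseHom :=
    congrArg FaltingsSite.Hom.baseHom ht
  have htc : t₁.coverHom ≫ g₁.coverHom = t₂.coverHom ≫ g₂.coverHom :=
    congrArg FaltingsSite.Hom.coverHom ht
  let u : T.base ⟶ U := fiberProd.homLift t₁.baseHom t₂.baseHom htb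
  have hu₁ : u ≫ q₁ = t₁.baseHom := fiberProd.homLift_fst _ _ _
  have hu₂ : u ≫ q₂ = t₂.baseHom := fiberProd.homLift_snd _ _ _
  have hc₁ : t₁.coverHom ≫ Z₁.cover.hom = (T.cover.hom ≫ gY f u) ≫ gY f q₁ := by
    rw [t₁.w, ← hu₁, gY_comp, Category.assoc]
  have hc₂ : t₂.coverHom ≫ Z₂.cover.hom = (T.cover.hom ≫ gY f u) ≫ gY f q₂ := by
    rw [t₂.w, ← hu₂, gY_comp, Category.assoc]
  let r₁ : T.cover.left ⟶ V₁.left := bcPair (V := Z₁.cover) t₁.coverHom _ hc₁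
  let r₂ : T.cover.left ⟶ V₂.left := bcPair (V := Z₂.cover) t₂.coverHom _ hc₂
  have hr : r₁ ≫ b₁.left = r₂ ≫ b₂.left := by
    refine bc_ext ?_ ?_
    · rw [Category.assoc, Category.assoc, hb₁, hb₂, ← Category.assoc, ← Category.assoc,
        bcPair_fst, bcPair_fst, htc]
    · rw [Category.assoc, Category.assoc, MorphismProperty.Over.w, MorphismProperty.Over.w,
        bcPair_hom, bcPair_hom]
  let k : T ⟶ W := ⟨u, fiberProd.lift b₁ b₂ r₁ r₂ hr,
    (fiberProd.lift_hom _ _ _ _ _).trans (bcPair_hom (V := Z₁.cover) _ _ hc₁)⟩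
  refine ⟨W, p₁, p₂, k, isCoh_fiberProd g₁.baseHom g₂.baseHom hZ.2.2 hZ₁.2 hZ₂.2, hp,
    FaltingsSite.hom_ext hu₁ ?_, FaltingsSite.hom_ext hu₂ ?_⟩
  · change fiberProd.lift b₁ b₂ r₁ r₂ hr ≫ (fiberProd.fst b₁ b₂).left ≫
      bcFst (gY f q₁) Z₁.cover = t₁.coverHom
    rw [← Category.assoc, fiberProd.lift_fst, bcPair_fst]
  · change fiberProd.lift b₁ b₂ r₁ r₂ hr ≫ (fiberProd.snd b₁ b₂).left ≫
      bcFst (gY f q₂) Z₂.cover = t₂.coverHom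
    rw [← Category.assoc, fiberProd.lift_snd, bcPair_fst]

/-- As the objects of finite presentation are stable under fibre products, sheaves on the Faltings
site restrict to sheaves on the subcategory that they form. -/
instance : (cohIncl f).IsContinuous (cohTopology f) (coevanescentTopology f) := by
  rw [← Functor.le_inducedTopology_iff]
  unfold cohTopology
  rw [Precoverage.toGrothendieck_le_iff_le_toPrecoverage]
  intro Z R hR
  apply Sheaf.mem_finestTopology_of_forall_isSheafFor
  rintro - ⟨G, rfl⟩ W a
  apply isSheafFor_of_functorPushforward_mem
  · constructor
    intro G Z T x hx Z₁ Z₂ W t₁ t₂ g₁ g₂ hg₁ hg₂ e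
    obtain ⟨W', p₁, p₂, k, hW, hp, rfl, rfl⟩ :=
      exists_lift_coh f Z.2 Z₁.2 Z₂.2 g₁.hom g₂.hom t₁ t₂ e
    let W'' : FaltingsSiteCoh f := ⟨W', hW⟩
    let p₁' : W'' ⟶ Z₁ := ⟨p₁⟩
    let p₂' : W'' ⟶ Z₂ := ⟨p₂⟩
    have hp' : p₁' ≫ g₁ = p₂' ≫ g₂ := ObjectProperty.hom_ext _ hp
    rw [presheaf_comp, presheaf_comp]
    exact congrArg (G.obj.map k.op) (hx p₁' p₂' hg₁ hg₂ hp')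
  -- A morphism which factors through a member of the family and through `a` also factors through
  -- their fibre product, which is of finite presentation.
  · have h := Precoverage.generate_mem_toGrothendieck (J := coevanescentPrecoverage f)
      (X := (cohIncl f).obj Z) (R := R.map (cohIncl f)) hR
    have h' := (coevanescentTopology f).pullback_stable ((cohIncl f).map a) h
    refine (coevanescentTopology f).superset_covering ?_ h'
    rintro T t ⟨_, b, _, ⟨hc⟩, e⟩
    rename_i Z' c
    obtain ⟨W', p₁, p₂, k, hW, hp, rfl, rfl⟩ :=
      exists_lift_coh f Z.2 Z'.2 W.2 c.hom a.hom b t e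
    refine ⟨⟨W', hW⟩, ⟨p₂⟩, k, ⟨Z', ⟨p₁⟩, c, hc, ObjectProperty.hom_ext _ hp⟩, rfl⟩

end Coh

/-! ### The comparison morphisms -/

noncomputable section Comparison

variable {X Y : Scheme.{u}} (f : Y ⟶ X) {F : Sheaf (fetTopology Y) (Type u)}
  {P : Sheaf (etTopology Y) (Type u)} (E : EtaleExtension F P)

namespace EtaleExtension

/-- The morphism `F ⟶ ρ_* P`. -/
def toRhoPush : F ⟶ (rhoPush Y).obj P := ⟨(etLifting Y).unit E⟩

/-- The morphism `F ⟶ β_* Ψ_* P`. -/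
def toBetaPush : F ⟶ (betaPush f).obj ((psiPush f).obj P) := ⟨(faltingsLifting f).unit E⟩

/-- The morphism from `F` to the direct image by `h_U` of the restriction of `P` to the finite étale
`U_Y`-schemes. -/
def toFetPush (U : Et X) :
    F ⟶ (fetPush (hMor f U)).obj ((alphaPush f U).obj ((psiPush f).obj P)) :=
  ⟨(uyLifting f U).unit E⟩

lemma isReflection_toRhoPush (hY : EtaleLocallyConnected Y) :
    IsReflection (rhoPush Y) E.toRhoPush :=
  (etLifting Y).isReflection E hY P.2

lemma isReflection_toBetaPush (hY : EtaleLocallyConnected Y) :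
    IsReflection (betaPush f) (E.toBetaPush f) :=
  (faltingsLifting f).isReflection E hY ((psiPush f).obj P).2

lemma isReflection_toFetPush (hY : EtaleLocallyConnected Y) (U : Et X) :
    IsReflection (fetPush (hMor f U)) (E.toFetPush f U) :=
  (uyLifting f U).isReflection E hY ((alphaPush f U).obj ((psiPush f).obj P)).2

/-- The sheaf `F` is the direct image of its extension. -/
lemma isIso_toRhoPush (hY : EtaleLocallyConnected Y) : IsIso E.toRhoPush := by
  have h : IsReflection (𝟭 _) E.toRhoPush :=
    (fetLifting Y).isReflection E hY ((rhoPush Y).obj P).2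
  exact h.isIso_of_id

/-- The universal morphism `F ⟶ β_* Ψ_* P` corresponds to `F ⟶ ρ_* P` by the isomorphism
`ρ_* ≅ β_* Ψ_*`. -/
lemma toRhoPush_rhoIso :
    E.toRhoPush ≫ (rhoIso f).hom.app P = E.toBetaPush f := by
  ext W x
  change P.obj.map ((betaPsiIso f).hom.app W.unop).op (E.sec (𝟙 _) x) =
    E.sec ((betaPsiIso f).hom.app W.unop) x
  rw [E.map_sec, Category.comp_id]

/-- The universal morphism for `h_U` is the composition of the one for `β` and of the restriction
maps `G(β⁺(W)) ⟶ G(W ×_Y U_Y ⟶ U)`. -/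
lemma toBetaPush_betaToAlpha (U : Et X) :
    E.toBetaPush f ≫ (betaToAlpha f U).app ((psiPush f).obj P) = E.toFetPush f U := by
  ext W x
  change P.obj.map ((psiPlus f).map (baseMapApp f (toSelf U) W.unop)).op
    (E.sec ((betaPsiIso f).hom.app W.unop) x) = E.sec ((uyLifting f U).counit.app W.unop) x
  rw [E.map_sec]
  exact congrArg (fun t => E.sec t x) (MorphismProperty.Over.Hom.ext (baseMapLeft_fst f _ _))

lemma isIso_toBetaPush (hY : EtaleLocallyConnected Y) : IsIso (E.toBetaPush f) := by
  have := E.isIso_toRhoPush hY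
  rw [← toRhoPush_rhoIso]
  infer_instance

variable {βs : Sheaf (fetTopology Y) (Type u) ⥤ Sheaf (coevanescentTopology f) (Type u)}
  (adjβ : βs ⊣ betaPush f)

variable {f}

lemma isIso_betaUnit (E : EtaleExtension F P) (hY : EtaleLocallyConnected Y) :
    IsIso (adjβ.unit.app F) := by
  have := E.isIso_toBetaPush f hY
  have := (E.isReflection_toBetaPush f hY).isIso adjβ
  have : IsIso (adjβ.unit.app F ≫
      (betaPush f).map ((adjβ.homEquiv _ _).symm (E.toBetaPush f))) := by
    rwa [unit_comp_map_homEquiv_symm]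
  exact IsIso.of_isIso_comp_right _
    ((betaPush f).map ((adjβ.homEquiv _ _).symm (E.toBetaPush f)))

lemma isIso_betaToPsiRho (E : EtaleExtension F P)
    {ρs : Sheaf (fetTopology Y) (Type u) ⥤ Sheaf (etTopology Y) (Type u)}
    (adjρ : ρs ⊣ rhoPush Y) (hY : EtaleLocallyConnected Y) :
    IsIso ((betaToPsiRho adjβ adjρ).app F) := by
  let e := (adjρ.homEquiv _ _).symm E.toRhoPush
  have : IsIso e := (E.isReflection_toRhoPush hY).isIso adjρ
  have he : adjρ.unit.app F ≫ (rhoPush Y).map e = E.toRhoPush :=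
    unit_comp_map_homEquiv_symm adjρ _
  have h : (betaToPsiRho adjβ adjρ).app F ≫ (psiPush f).map e =
      (adjβ.homEquiv _ _).symm (E.toBetaPush f) := by
    change (adjβ.homEquiv _ _).symm (adjρ.unit.app F ≫ (rhoIso f).hom.app (ρs.obj F)) ≫ _ = _
    rw [← adjβ.homEquiv_naturality_right_symm, ← E.toRhoPush_rhoIso f, ← he, Category.assoc,
      Category.assoc]
    exact congrArg (fun m => (adjβ.homEquiv _ _).symm (adjρ.unit.app F ≫ m))
      ((rhoIso f).hom.naturality e).symm
  have : IsIso ((betaToPsiRho adjβ adjρ).app F ≫ (psiPush f).map e) := by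
    rw [h]
    exact (E.isReflection_toBetaPush f hY).isIso adjβ
  exact IsIso.of_isIso_comp_right _ ((psiPush f).map e)

lemma isIso_invImageToBetaAt (E : EtaleExtension F P)
    {L : ∀ U : Et X, Sheaf (fetTopology Y) (Type u) ⥤ Sheaf (fetTopology (UY f U)) (Type u)}
    (adj : ∀ U : Et X, L U ⊣ fetPush (hMor f U)) (hY : EtaleLocallyConnected Y) (U : Et X) :
    IsIso (invImageToBetaAt adj adjβ F U) := by
  let e := (adjβ.homEquiv _ _).symm (E.toBetaPush f)
  have : IsIso e := (E.isReflection_toBetaPush f hY).isIso adjβ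
  have he : adjβ.unit.app F ≫ (betaPush f).map e = E.toBetaPush f :=
    unit_comp_map_homEquiv_symm adjβ _
  have h : invImageToBetaAt adj adjβ F U ≫ (alphaPush f U).map e =
      ((adj U).homEquiv _ _).symm (E.toFetPush f U) := by
    change ((adj U).homEquiv _ _).symm
      (adjβ.unit.app F ≫ (betaToAlpha f U).app (βs.obj F)) ≫ _ = _
    rw [← (adj U).homEquiv_naturality_right_symm, ← E.toBetaPush_betaToAlpha f, ← he,
      Category.assoc, Category.assoc]
    exact congrArg (fun m => ((adj U).homEquiv _ _).symm (adjβ.unit.app F ≫ m))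
      ((betaToAlpha f U).naturality e).symm
  have : IsIso (invImageToBetaAt adj adjβ F U ≫ (alphaPush f U).map e) := by
    rw [h]
    exact (E.isReflection_toFetPush f hY U).isIso (adj U)
  exact IsIso.of_isIso_comp_right _ ((alphaPush f U).map e)

end EtaleExtension

end Comparison

end Faltings

theorem proposition10p7 {X Y : Scheme.{u}} (f : Y ⟶ X) [QuasiSeparatedSpace X]
    [CompactSpace Y] [QuasiSeparatedSpace Y] (hY : EtaleLocallyConnected Y) :
    -- the inverse image functors `β^*`, `ρ^*` and `(h_U)^*` exist
    ((betaPush f).IsRightAdjoint ∧ (rhoPush Y).IsRightAdjoint ∧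
      ∀ U : Et X, (fetPush (hMor f U)).IsRightAdjoint) ∧
    -- and, for any choice of them,
    ∀ (βs : Sheaf (fetTopology Y) (Type u) ⥤ Sheaf (coevanescentTopology f) (Type u))
      (adjβ : βs ⊣ betaPush f)
      (ρs : Sheaf (fetTopology Y) (Type u) ⥤ Sheaf (etTopology Y) (Type u))
      (adjρ : ρs ⊣ rhoPush Y)
      (hs : ∀ U : Et X,
        Sheaf (fetTopology Y) (Type u) ⥤ Sheaf (fetTopology (UY f U)) (Type u))
      (adjh : ∀ U : Et X, hs U ⊣ fetPush (hMor f U)),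
      -- the presheaf `(V ⟶ U) ↦ ((h_U)^* F)(V)` is a sheaf on `E_coh`, and it is `β^* F`
      (∀ F : Sheaf (fetTopology Y) (Type u),
        Presheaf.IsSheaf (cohTopology f) ((cohIncl f).op ⋙ invImagePresheaf adjh F) ∧
        IsIso (Functor.whiskerLeft (cohIncl f).op (invImageToBeta adjh adjβ F))) ∧
      -- the unit `𝟭 ⟶ β_* β^*` is an isomorphism
      IsIso adjβ.unit ∧
      -- the canonical morphism `β^* ⟶ Ψ_* ρ^*` is an isomorphism
      IsIso (betaToPsiRho adjβ adjρ) := by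
  choose P E using fun F : Sheaf (fetTopology Y) (Type u) => exists_etaleExtension F
  refine ⟨⟨?_, ?_, fun U => ?_⟩, fun βs adjβ ρs adjρ hs adjh => ⟨fun F => ?_, ?_, ?_⟩⟩
  · exact isRightAdjoint_of_isReflection _ fun F =>
      ⟨_, _, (E F).some.isReflection_toBetaPush f hY⟩
  · exact isRightAdjoint_of_isReflection _ fun F => ⟨_, _, (E F).some.isReflection_toRhoPush hY⟩
  · exact isRightAdjoint_of_isReflection _ fun F =>
      ⟨_, _, (E F).some.isReflection_toFetPush f hY U⟩
  · have : IsIso (invImageToBeta adjh adjβ F) := by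
      have (Z : (FaltingsSite f)ᵒᵖ) : IsIso ((invImageToBeta adjh adjβ F).app Z) := by
        have := (E F).some.isIso_invImageToBetaAt adjβ adjh hY Z.unop.base
        exact inferInstanceAs (IsIso (((sheafToPresheaf _ _).map
          (invImageToBetaAt adjh adjβ F Z.unop.base)).app (op Z.unop.cover)))
      exact NatIso.isIso_of_isIso_app _
    refine ⟨?_, inferInstance⟩
    exact (Presheaf.isSheaf_of_iso_iff (asIso (Functor.whiskerLeft (cohIncl f).op
      (invImageToBeta adjh adjβ F)))).2
      (Functor.op_comp_isSheaf (cohIncl f) (cohTopology f) (coevanescentTopology f) (βs.obj F))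
  · have h (F : Sheaf (fetTopology Y) (Type u)) := (E F).some.isIso_betaUnit adjβ hY
    exact NatIso.isIso_of_isIso_app _
  · have h (F : Sheaf (fetTopology Y) (Type u)) := (E F).some.isIso_betaToPsiRho adjβ adjρ hY
    exact NatIso.isIso_of_isIso_app _
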